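/- Let $\mathcal A$ be a commutative $\mathbb C$-algebra without zero divisors, equipped with a derivation $\partial$ such that $\ker\partial=\mathbb C$; extend $\partial$ to the field of fractions $\mathrm{Frac}(\mathcal A)$. Let $\mathcal C_0\subset\mathcal A$ be a differential subalgebra (so $\mathbb C\subset\mathcal C_0$ and $\partial\mathcal C_0\subset\mathcal C_0$), and view $\mathrm{Frac}(\mathcal C_0)\subset\mathrm{Frac}(\mathcal A)$. Let $\mathcal X$ be a totally ordered alphabet (finite or infinite), let $(u_x)_{x\in\mathcal X}$ be a family of elements of $\mathcal C_0$, and put $M=\sum_{x\in\mathcal X}u_x\,x$. For a noncommutative series $S=\sum_{w\in\mathcal X^*}\langle S|w\rangle w$ with coefficients in $\mathcal A$, put $\mathbf dS=\sum_w(\partial\langle S|w\rangle)\,w$. The series $S$ is called group-like if $\langle S|1_{\mathcal X^*}\rangle=1$ and $\langle S|v\sqcup\!\!\sqcup w\rangle=\langle S|v\rangle\langle S|w\rangle$ for all words $v,w$, where $\sqcup\!\!\sqcup$ is the shuffle product. A Lie series over $\mathbb C$ is a series all of whose homogeneous components (for the grading of words by all partial degrees) are Lie polynomials with coefficients in $\mathbb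 C$. Let $S\in\mathcal A\langle\langle\mathcal X\rangle\rangle$ be a group-like solution of $$\mathbf dS=MS,\qquad\langle S|1_{\mathcal X^*}\rangle=1 .$$ 1. A series $H\in\mathcal A\langle\langle\mathcal X\rangle\rangle$ is a group-like solution of the same equation if and only if there is a Lie series $C$ over $\mathbb C$ such that $S=He^{C}$. 2. Suppose moreover that passing to fractions with denominators in $\mathcal C_0$ creates no new constants: if $a\in\mathcal A$, $b\in\mathcal C_0\setminus\{0\}$ and $\partial(a/b)=0$ in $\mathrm{Frac}(\mathcal A)$, then $a/b\in\mathbb C$. (This is automatic if $\mathcal C_0$ is a field, or if the field of constants of $\mathrm{Frac}(\mathcal A)$ is $\mathbb C$, e.g. if $\mathcal A$ is a ring of holomorphic functions on a connected domain with $\partial=d/dz$.) Then the following assertions are equivalent: (a) the family $(\langle S|w\rangle)_{w\in\mathcal X^*}$ is $\mathcal C_0$-linearly independent; (b) the family $(\langle S|l\rangle)_{l}$, with $l$ running over the Lyndon words over $\mathcal X$, is $\mathcal C_0$-algebraically independent; (c) the family $(\langle S|x\rangle)_{x\in\mathcal X}$ is $\mathcal C_0$-algebraically independent; (d) the family $(\langle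 S|x\rangle)_{x\in\mathcal X\cup\{1_{\mathcal X^*}\}}$ is $\mathcal C_0$-linearly independent; (e) for all $f\in\mathrm{Frac}(\mathcal C_0)$ and all finitely supported families $(c_x)_{x\in\mathcal X}$ in $\mathbb C$, if $\sum_{x}c_xu_x=\partial f$, then $c_x=0$ for all $x\in\mathcal X$; (f) the family $(u_x)_{x\in\mathcal X}$ is linearly independent over $\mathbb C$ and $\partial\,\mathrm{Frac}(\mathcal C_0)\cap\mathrm{span}_{\mathbb C}\{u_x\}_{x\in\mathcal X}=\{0\}$. -/

import Mathlib

/-- Noncommutative formal power series over the alphabet `X` with coefficients in `R`: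
a coefficient for every word (a list of letters). -/
def NCSeries (R X : Type*) : Type _ := List X → R

namespace NCSeries

section Basic

variable {R X : Type*}

/-- The coefficient `⟨S|w⟩` of the series `S` at the word `w`. -/
def coeff (S : NCSeries R X) (w : List X) : R := S w

/-- The series with the given coefficients. -/
def mk (f : List X → R) : NCSeries R X := f

@[simp] theorem coeff_mk (f : List X → R) (w : List X) : (mk f).coeff w = f w := rfl

@[ext] theorem ext {S T : NCSeries R X} (h : ∀ w, S.coeff w = T.coeff w) : S = T := funext h

instance [CommRing R] : AddCommGroup (NCSeries R X) :=
  inferInstanceAs (AddCommGroup (List X → R))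

instance [CommRing R] : Module R (NCSeries R X) :=
  inferInstanceAs (Module R (List X → R))

variable [CommRing R]

/-- The empty word. -/
instance : One (NCSeries R X) := ⟨mk fun w => if w.length = 0 then 1 else 0⟩

/-- The concatenation (Cauchy) product: the sum runs over all factorizations `w = uv`. -/
instance : Mul (NCSeries R X) :=
  ⟨fun S T => mk fun w =>
    ∑ i ∈ Finset.range (w.length + 1), S.coeff (w.take i) * T.coeff (w.drop i)⟩

@[simp] theorem coeff_zero (w : List X) : (0 : NCSeries R X).coeff w = 0 := rfl

@[simp] theorem coeff_add (S T : NCSeries R X) (w : List X) :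
    (S + T).coeff w = S.coeff w + T.coeff w := rfl

@[simp] theorem coeff_smul (r : R) (S : NCSeries R X) (w : List X) :
    (r • S).coeff w = r * S.coeff w := rfl

theorem coeff_one (w : List X) :
    (1 : NCSeries R X).coeff w = if w.length = 0 then 1 else 0 := rfl

theorem coeff_mul (S T : NCSeries R X) (w : List X) :
    (S * T).coeff w =
      ∑ i ∈ Finset.range (w.length + 1), S.coeff (w.take i) * T.coeff (w.drop i) := rfl

theorem coeff_mul_nil (S T : NCSeries R X) :
    (S * T).coeff [] = S.coeff [] * T.coeff [] := by
  simp [coeff_mul]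

theorem coeff_mul_cons (S T : NCSeries R X) (x : X) (w : List X) :
    (S * T).coeff (x :: w) =
      S.coeff [] * T.coeff (x :: w) + ((mk fun v => S.coeff (x :: v)) * T).coeff w := by
  rw [coeff_mul, List.length_cons, Finset.sum_range_succ', add_comm]
  simp [coeff_mul]

private theorem mul_assoc_aux (w : List X) : ∀ S T U : NCSeries R X,
    (S * T * U).coeff w = (S * (T * U)).coeff w := by
  induction w with
  | nil => intro S T U; simp only [coeff_mul_nil, mul_assoc]
  | cons x w ih =>
    intro S T U
    have h : (mk fun v => (S * T).coeff (x :: v)) =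
        S.coeff [] • (mk fun v => T.coeff (x :: v)) + (mk fun v => S.coeff (x :: v)) * T := by
      ext v
      rw [coeff_mk, coeff_mul_cons, coeff_add, coeff_smul, coeff_mk]
    have h2 : ∀ (r : R) (P Q V : NCSeries R X),
        ((r • P + Q) * V).coeff w = r * (P * V).coeff w + (Q * V).coeff w := by
      intro r P Q V
      simp only [coeff_mul, coeff_add, coeff_smul, Finset.mul_sum, ← Finset.sum_add_distrib]
      exact Finset.sum_congr rfl fun i _ => by ring
    rw [coeff_mul_cons, h, h2, ih, coeff_mul_cons S, coeff_mul_cons T, coeff_mul_nil]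
    ring

instance : Ring (NCSeries R X) :=
  { (inferInstance : AddCommGroup (NCSeries R X)),
    (inferInstance : One (NCSeries R X)),
    (inferInstance : Mul (NCSeries R X)) with
    left_distrib := fun S T U => by
      ext w
      simp only [coeff_mul, coeff_add, mul_add, Finset.sum_add_distrib]
    right_distrib := fun S T U => by
      ext w
      simp only [coeff_mul, coeff_add, add_mul, Finset.sum_add_distrib]
    zero_mul := fun S => by ext w; simp [coeff_mul]
    mul_zero := fun S => by ext w; simp [coeff_mul]
    mul_assoc := fun S T U => ext fun w => mul_assoc_aux w S T U
    one_mul := fun S => by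
      ext w
      rw [coeff_mul, Finset.sum_eq_single 0]
      · simp [coeff_one]
      · intro i hi h0
        have : min i w.length ≠ 0 := by
          have := Finset.mem_range.1 hi
          omega
        rw [coeff_one, List.length_take, if_neg this, zero_mul]
      · intro h; simp at h
    mul_one := fun S => by
      ext w
      rw [coeff_mul, Finset.sum_eq_single w.length]
      · simp [coeff_one]
      · intro i hi h0
        have : w.length - i ≠ 0 := by
          have := Finset.mem_range.1 hi
          omega
        rw [coeff_one, List.length_drop, if_neg this, mul_zero]
      · intro h; simp at h }

instance : Algebra R (NCSeries R X) :=
  Algebra.ofModule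
    (fun r S T => by
      ext w
      simp only [coeff_mul, coeff_smul, Finset.mul_sum, mul_assoc])
    (fun r S T => by
      ext w
      simp only [coeff_mul, coeff_smul, Finset.mul_sum]
      exact Finset.sum_congr rfl fun i _ => by ring)

/-- The commutator bracket `⁅S, T⁆ = S * T - T * S`. -/
instance : LieRing (NCSeries R X) := LieRing.ofAssociativeRing

instance : LieAlgebra R (NCSeries R X) := LieAlgebra.ofAssociativeAlgebra

/-- The homogeneous series of degree one `∑ x, c x • x` (the alphabet may be infinite). -/
def ofLetters (c : X → R) : NCSeries R X :=
  mk fun w => match w with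
    | [x] => c x
    | _ => 0

open Classical in
/-- The letter `x`, as a series. -/
noncomputable def letter (R : Type*) {X : Type*} [CommRing R] (x : X) : NCSeries R X :=
  mk fun w => if w = [x] then 1 else 0

/-- Image of a series under a change of coefficients. -/
def map {T : Type*} (f : R → T) (S : NCSeries R X) : NCSeries T X := mk fun w => f (S.coeff w)

/-- The words occurring in the shuffle product of two words, with multiplicity:
`xu ⧢ yv = x (u ⧢ yv) + y (xu ⧢ v)`. -/
def shuffle {X : Type*} : List X → List X → List (List X)
  | [], v => [v]
  | u, [] => [u]
  | x :: u, y :: v =>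
    (shuffle u (y :: v)).map (x :: ·) ++ (shuffle (x :: u) v).map (y :: ·)
termination_by u v => u.length + v.length

/-- Group-like series for the shuffle coproduct: `⟨S|1⟩ = 1` and
`⟨S|u ⧢ v⟩ = ⟨S|u⟩⟨S|v⟩` for all words `u`, `v`. -/
def IsGroupLike (S : NCSeries R X) : Prop :=
  S.coeff [] = 1 ∧
    ∀ u v : List X, ((shuffle u v).map S.coeff).sum = S.coeff u * S.coeff v

open Classical in
/-- The component of a series in the multidegree `m` (for the fine grading of words by
all partial degrees). It is a polynomial, whatever the alphabet. -/
noncomputable def component (m : Multiset X) (S : NCSeries R X) : NCSeries R X :=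
  mk fun w => if (w : Multiset X) = m then S.coeff w else 0

/-- Lie polynomials: the Lie subalgebra generated by the letters, for the commutator bracket. -/
noncomputable def liePolynomials (R X : Type*) [CommRing R] : LieSubalgebra R (NCSeries R X) :=
  LieSubalgebra.lieSpan R (NCSeries R X) (Set.range (letter R : X → NCSeries R X))

/-- Lie series: every homogeneous component for the fine grading is a Lie polynomial. -/
def IsLieSeries (S : NCSeries R X) : Prop :=
  ∀ m : Multiset X, S.component m ∈ liePolynomials R X

/-- Coefficientwise derivation `𝐝 S = ∑ w, (∂ ⟨S|w⟩) w`. -/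
def deriv {k : Type*} [CommRing k] [Algebra k R] (D : Derivation k R R) (S : NCSeries R X) :
    NCSeries R X :=
  S.map D

/-- Solutions of `𝐝 S = M S`, `⟨S|1⟩ = 1`, where `M = ∑ x, u x • x`. -/
def IsSolution {k : Type*} [CommRing k] [Algebra k R] (D : Derivation k R R) (u : X → R)
    (S : NCSeries R X) : Prop :=
  S.deriv D = ofLetters u * S ∧ S.coeff [] = 1

end Basic

/-- The exponential `∑ n, C ^ n / n!` of a series `C` without constant term. For such a series
`⟨C ^ n|w⟩ = 0` as soon as `n` exceeds the length of `w`, so every coefficient is a finite sum. -/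
noncomputable def exp {K X : Type*} [Field K] (C : NCSeries K X) : NCSeries K X :=
  mk fun w => ∑ n ∈ Finset.range (w.length + 1), (n.factorial : K)⁻¹ * (C ^ n).coeff w

end NCSeries

/-- Lyndon words over a totally ordered alphabet: nonempty words that are strictly smaller, for
the lexicographic order, than all their nonempty proper right factors. -/
def IsLyndon {X : Type*} [LinearOrder X] (l : List X) : Prop :=
  l ≠ [] ∧ ∀ u v : List X, u ≠ [] → v ≠ [] → l = u ++ v → l < v

section Fractions

variable {k A : Type*} [CommRing k] [CommRing A] [IsDomain A] [Algebra k A]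

/-- Auxiliary function for the extension of a derivation to the field of fractions. -/
noncomputable def fracDerivFun (D : Derivation k A A) (f : FractionRing A) : FractionRing A :=
  let a := (IsLocalization.sec (nonZeroDivisors A) f).1
  let b : A := (IsLocalization.sec (nonZeroDivisors A) f).2
  algebraMap A (FractionRing A) (D a * b - a * D b) / algebraMap A (FractionRing A) b ^ 2

/-- The quotient rule. -/
theorem fracDerivFun_div (D : Derivation k A A) (a b : A) (hb : b ≠ 0) :
    fracDerivFun D (algebraMap A (FractionRing A) a / algebraMap A (FractionRing A) b) =
      algebraMap A (FractionRing A) (D a * b - a * D b) /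
        algebraMap A (FractionRing A) b ^ 2 := by
  have hinj : Function.Injective (algebraMap A (FractionRing A)) :=
    IsFractionRing.injective A (FractionRing A)
  have hne : ∀ c : A, c ≠ 0 → algebraMap A (FractionRing A) c ≠ 0 := fun c hc h =>
    hc (hinj (by rw [h, map_zero]))
  set f := algebraMap A (FractionRing A) a / algebraMap A (FractionRing A) b with hf
  have hspec := IsLocalization.sec_spec (nonZeroDivisors A) f
  have hd : ((IsLocalization.sec (nonZeroDivisors A) f).2 : A) ≠ 0 :=
    nonZeroDivisors.coe_ne_zero _
  unfold fracDerivFun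
  generalize (IsLocalization.sec (nonZeroDivisors A) f).1 = c at hspec hd ⊢
  generalize ((IsLocalization.sec (nonZeroDivisors A) f).2 : A) = d at hspec hd ⊢
  have h1 : a * d = c * b := by
    apply hinj
    rw [map_mul, map_mul, ← hspec, hf]
    field_simp [hne b hb]
  have h2 : D a * d + a * D d = D c * b + c * D b := by
    have := congrArg D h1
    simp only [Derivation.leibniz, smul_eq_mul] at this
    linear_combination this
  rw [div_eq_div_iff (pow_ne_zero 2 (hne d hd)) (pow_ne_zero 2 (hne b hb)),
    ← map_pow, ← map_pow, ← map_mul, ← map_mul]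
  congr 1
  linear_combination (-b * d) * h2 + (b * D d + d * D b) * h1

theorem exists_frac (f : FractionRing A) :
    ∃ a b : A, b ≠ 0 ∧
      f = algebraMap A (FractionRing A) a / algebraMap A (FractionRing A) b := by
  obtain ⟨a, b, hb, h⟩ := IsFractionRing.div_surjective (A := A) f
  exact ⟨a, b, nonZeroDivisors.ne_zero hb, h.symm⟩

/-- The unique extension of a derivation of an integral domain to its field of fractions. -/
noncomputable def fracDeriv (D : Derivation k A A) :
    Derivation k (FractionRing A) (FractionRing A) :=
  have hne : ∀ c : A, c ≠ 0 → algebraMap A (FractionRing A) c ≠ 0 := fun c hc h =>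
    hc (IsFractionRing.injective A (FractionRing A) (by rw [h, map_zero]))
  Derivation.mk'
    { toFun := fracDerivFun D
      map_add' := by
        intro f g
        obtain ⟨a, b, hb, rfl⟩ := exists_frac f
        obtain ⟨c, d, hd, rfl⟩ := exists_frac g
        rw [div_add_div _ _ (hne b hb) (hne d hd), ← map_mul, ← map_mul, ← map_mul, ← map_add,
          fracDerivFun_div D _ _ (mul_ne_zero hb hd), fracDerivFun_div D _ _ hb,
          fracDerivFun_div D _ _ hd]
        simp only [Derivation.leibniz, smul_eq_mul, map_add, map_sub, map_mul]
        field_simp [hne b hb, hne d hd]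
        ring
      map_smul' := by
        intro r f
        obtain ⟨a, b, hb, rfl⟩ := exists_frac f
        have h : ∀ y : FractionRing A, r • y = algebraMap A (FractionRing A)
            (algebraMap k A r) * y := by
          intro y
          rw [← IsScalarTower.algebraMap_apply, Algebra.smul_def]
        rw [RingHom.id_apply, h, h, ← mul_div_assoc, ← map_mul, fracDerivFun_div D _ _ hb,
          fracDerivFun_div D _ _ hb]
        simp only [Derivation.leibniz, Derivation.map_algebraMap, smul_eq_mul, map_add, map_sub,
          map_mul, map_zero]
        ring }
    (by
      intro f g
      obtain ⟨a, b, hb, rfl⟩ := exists_frac f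
      obtain ⟨c, d, hd, rfl⟩ := exists_frac g
      change fracDerivFun D _ = _ • fracDerivFun D _ + _ • fracDerivFun D _
      rw [div_mul_div_comm, ← map_mul, ← map_mul,
        fracDerivFun_div D _ _ (mul_ne_zero hb hd), fracDerivFun_div D _ _ hb,
        fracDerivFun_div D _ _ hd]
      simp only [Derivation.leibniz, smul_eq_mul, map_add, map_sub, map_mul]
      field_simp [hne b hb, hne d hd]
      ring)

theorem fracDeriv_algebraMap (D : Derivation k A A) (a : A) :
    fracDeriv D (algebraMap A (FractionRing A) a) = algebraMap A (FractionRing A) (D a) := by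
  have h := fracDerivFun_div D a 1 one_ne_zero
  rw [map_one, div_one, Derivation.map_one_eq_zero, mul_one, mul_zero, sub_zero, one_pow,
    div_one] at h
  exact h

theorem fracDeriv_div (D : Derivation k A A) (a b : A) (hb : b ≠ 0) :
    fracDeriv D (algebraMap A (FractionRing A) a / algebraMap A (FractionRing A) b) =
      algebraMap A (FractionRing A) (D a * b - a * D b) /
        algebraMap A (FractionRing A) b ^ 2 :=
  fracDerivFun_div D a b hb

/-- The field of fractions of a subalgebra `C₀` of `A`, inside the field of fractions of `A`. -/
noncomputable def fracSubfield {F : Type*} [Field F] [Algebra F A] (C₀ : Subalgebra F A) :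
    IntermediateField F (FractionRing A) :=
  IntermediateField.adjoin F (algebraMap A (FractionRing A) '' (C₀ : Set A))

end Fractions

/-! Assertion 1. If `S` and `H` both solve the equation, write `S = HT`. Differentiating gives `H 𝐝T
= 0`, so `𝐝T = 0` and the coefficients of `T` are constants. If both are group-like, so is `T`. A
group-like series in characteristic zero is the exponential of a primitive one, constructed degree
by degree (`IsGroupLike.exists_exp_eq`), and primitive series are Lie series by Friedrichs'
criterion (`IsPrimitive.isLieSeries`). The latter uses the adjoint of Dynkin's operator: it sends
words to iterated brackets and multiplies a primitive homogeneous component by its degree.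
Conversely, the exponential of a Lie series is group-like with constant coefficients, and such a
right factor can be cancelled both from the equation and from the group-like property.

Assertion 2 is the cycle (a) → (b) → (c) → (d) → (e) → (a), together with the elementary (e) ↔ (f).
For (a) → (b), a group-like series turns a monomial in the `⟨S|l⟩` into the coefficient of a shuffle
of Lyndon words. The largest word of that shuffle is the nonincreasing concatenation
(`IsShuffleOf.le_flatten`), which determines the monomial (`lyndon_factorization_unique`). By
triangularity, an algebraic relation would give a nontrivial linear one. (b) → (c) holds because
letters are Lyndon words, and (c) → (d) because `1` and the variables are distinct monomials. For
(d) → (e), `∑ c_x ⟨S|x⟩` is a primitive of `∑ c_x u_x`. If `f` is another, the difference is a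
constant, and clearing the denominator of `f` gives a linear relation. For (e) → (a)
(`IsSolution.relation_eq_zero`), take a relation over `Frac C₀` with as few words of top length as
possible and one top coefficient equal to 1. Its derivative has fewer top words, hence is zero. The
top coefficients are therefore constants, and the coefficients one length below provide a primitive
forbidden by (e). -/

namespace NCSeries

/-! ### Pairing of series with shuffle products -/

section ShufflePairing

variable {R X : Type*}

theorem shuffle_nil_left (v : List X) : shuffle [] v = [v] := by
  rw [shuffle]

theorem shuffle_nil_right (u : List X) : shuffle u [] = [u] := by
  cases u <;> simp [shuffle]

theorem shuffle_cons_cons (x y : X) (u v : List X) :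
    shuffle (x :: u) (y :: v) =
      (shuffle u (y :: v)).map (x :: ·) ++ (shuffle (x :: u) v).map (y :: ·) := by
  rw [shuffle]

theorem perm_of_mem_shuffle : ∀ {u v w : List X}, w ∈ shuffle u v → w.Perm (u ++ v)
  | [], v, w, h => by
    rw [shuffle_nil_left, List.mem_singleton] at h
    simp [h]
  | x :: u, [], w, h => by
    rw [shuffle_nil_right, List.mem_singleton] at h
    simp [h]
  | x :: u, y :: v, w, h => by
    rw [shuffle_cons_cons, List.mem_append, List.mem_map, List.mem_map] at h
    rcases h with ⟨w', h, rfl⟩ | ⟨w', h, rfl⟩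
    · exact (perm_of_mem_shuffle h).cons x
    · exact ((perm_of_mem_shuffle h).cons y).trans List.perm_middle.symm
termination_by u v => u.length + v.length

/-- The left residual `x⁻¹ S`. -/
def residual (x : X) (S : NCSeries R X) : NCSeries R X := mk fun v => S.coeff (x :: v)

@[simp] theorem coeff_residual (x : X) (S : NCSeries R X) (w : List X) :
    (residual x S).coeff w = S.coeff (x :: w) := rfl

variable [CommRing R]

@[simp] theorem coeff_sub (S T : NCSeries R X) (w : List X) :
    (S - T).coeff w = S.coeff w - T.coeff w := rfl

theorem coeff_sum {ι : Type*} (s : Finset ι) (f : ι → NCSeries R X) (w : List X) :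
    (∑ i ∈ s, f i).coeff w = ∑ i ∈ s, (f i).coeff w := by
  classical
  induction s using Finset.induction_on with
  | empty => simp
  | insert a s ha ih => rw [Finset.sum_insert ha, Finset.sum_insert ha, coeff_add, ih]

theorem coeff_one_nil : (1 : NCSeries R X).coeff [] = 1 := by simp [coeff_one]

theorem coeff_one_cons (x : X) (w : List X) : (1 : NCSeries R X).coeff (x :: w) = 0 := by
  simp [coeff_one]

theorem residual_mul (x : X) (S T : NCSeries R X) :
    residual x (S * T) = S.coeff [] • residual x T + residual x S * T := by
  ext w
  rw [coeff_residual, coeff_mul_cons]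
  rfl

/-- The pairing of a series with a shuffle product of two words. -/
def shuffleCoeff (S : NCSeries R X) (u v : List X) : R := ((shuffle u v).map S.coeff).sum

@[simp] theorem shuffleCoeff_nil_left (S : NCSeries R X) (v : List X) :
    shuffleCoeff S [] v = S.coeff v := by
  simp [shuffleCoeff, shuffle_nil_left]

@[simp] theorem shuffleCoeff_nil_right (S : NCSeries R X) (u : List X) :
    shuffleCoeff S u [] = S.coeff u := by
  simp [shuffleCoeff, shuffle_nil_right]

theorem shuffleCoeff_cons_cons (S : NCSeries R X) (x y : X) (u v : List X) :
    shuffleCoeff S (x :: u) (y :: v) =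
      shuffleCoeff (residual x S) u (y :: v) + shuffleCoeff (residual y S) (x :: u) v := by
  simp only [shuffleCoeff, shuffle_cons_cons, List.map_append, List.sum_append, List.map_map]
  rfl

theorem shuffleCoeff_congr {S T : NCSeries R X} {u v : List X}
    (h : ∀ w : List X, w.Perm (u ++ v) → S.coeff w = T.coeff w) :
    shuffleCoeff S u v = shuffleCoeff T u v := by
  unfold shuffleCoeff
  rw [List.map_congr_left fun w hw => h w (perm_of_mem_shuffle hw)]

theorem shuffleCoeff_eq_zero {S : NCSeries R X} {u v : List X}
    (h : ∀ w : List X, w.Perm (u ++ v) → S.coeff w = 0) : shuffleCoeff S u v = 0 := by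
  rw [shuffleCoeff, List.sum_eq_zero]
  intro r hr
  obtain ⟨w, hw, rfl⟩ := List.mem_map.1 hr
  exact h w (perm_of_mem_shuffle hw)

@[simp] theorem shuffleCoeff_add (S T : NCSeries R X) (u v : List X) :
    shuffleCoeff (S + T) u v = shuffleCoeff S u v + shuffleCoeff T u v := by
  exact List.sum_map_add

@[simp] theorem shuffleCoeff_smul (r : R) (S : NCSeries R X) (u v : List X) :
    shuffleCoeff (r • S) u v = r * shuffleCoeff S u v := by
  exact List.sum_map_mul_left (shuffle u v) S.coeff r

@[simp] theorem shuffleCoeff_zero (u v : List X) :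
    shuffleCoeff (0 : NCSeries R X) u v = 0 :=
  shuffleCoeff_eq_zero fun _ _ => rfl

@[simp] theorem shuffleCoeff_sub (S T : NCSeries R X) (u v : List X) :
    shuffleCoeff (S - T) u v = shuffleCoeff S u v - shuffleCoeff T u v := by
  have h := shuffleCoeff_add (S - T) T u v
  rw [sub_add_cancel] at h
  rw [h, add_sub_cancel_right]

theorem shuffleCoeff_sum {ι : Type*} (s : Finset ι) (f : ι → NCSeries R X) (u v : List X) :
    shuffleCoeff (∑ i ∈ s, f i) u v = ∑ i ∈ s, shuffleCoeff (f i) u v := by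
  classical
  induction s using Finset.induction_on with
  | empty => simp
  | insert a s ha ih =>
    rw [Finset.sum_insert ha, Finset.sum_insert ha, shuffleCoeff_add, ih]

/-- Deconcatenation is compatible with the shuffle product. -/
theorem shuffleCoeff_mul : ∀ (u v : List X) (S T : NCSeries R X),
    shuffleCoeff (S * T) u v = ∑ i ∈ Finset.range (u.length + 1),
      ∑ j ∈ Finset.range (v.length + 1),
        shuffleCoeff S (u.take i) (v.take j) * shuffleCoeff T (u.drop i) (v.drop j)
  | [], v, S, T => by simp [coeff_mul]
  | x :: u, [], S, T => by simp [coeff_mul]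
  | x :: u, y :: v, S, T => by
    rw [shuffleCoeff_cons_cons, residual_mul, residual_mul, shuffleCoeff_add, shuffleCoeff_add,
      shuffleCoeff_smul, shuffleCoeff_smul, shuffleCoeff_mul u (y :: v),
      shuffleCoeff_mul (x :: u) v]
    simp only [List.length_cons]
    -- The terms with an empty prefix of either word are split off: the first-letter recursion of
    -- the shuffle applies to the prefixes only when both are nonempty.
    rw [Finset.sum_range_succ' _ (u.length + 1)]
    simp only [Finset.sum_range_succ' _ (v.length + 1), Finset.sum_range_succ' _ (u.length + 1),
      List.take_succ_cons, List.drop_succ_cons, List.take_zero, List.drop_zero,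
      shuffleCoeff_cons_cons, shuffleCoeff_nil_left, shuffleCoeff_nil_right, coeff_residual,
      add_mul, Finset.sum_add_distrib]
    ring
termination_by u v => u.length + v.length

end ShufflePairing

/-! ### Products and quotients of group-like series -/

section GroupLike

variable {R X : Type*} [CommRing R]

theorem isGroupLike_iff {S : NCSeries R X} :
    S.IsGroupLike ↔ S.coeff [] = 1 ∧
      ∀ u v : List X, shuffleCoeff S u v = S.coeff u * S.coeff v := Iff.rfl

theorem coeff_mul_coeff_mul (S T : NCSeries R X) (u v : List X) :
    (S * T).coeff u * (S * T).coeff v = ∑ i ∈ Finset.range (u.length + 1),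
      ∑ j ∈ Finset.range (v.length + 1),
        (S.coeff (u.take i) * S.coeff (v.take j)) * (T.coeff (u.drop i) * T.coeff (v.drop j)) := by
  rw [coeff_mul, coeff_mul, Finset.sum_mul_sum]
  exact Finset.sum_congr rfl fun i _ => Finset.sum_congr rfl fun j _ => by ring

theorem IsGroupLike.mul {S T : NCSeries R X} (hS : S.IsGroupLike) (hT : T.IsGroupLike) :
    (S * T).IsGroupLike := by
  refine isGroupLike_iff.2 ⟨by rw [coeff_mul_nil, hS.1, hT.1, one_mul], fun u v => ?_⟩
  rw [shuffleCoeff_mul, coeff_mul_coeff_mul]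
  exact Finset.sum_congr rfl fun i _ => Finset.sum_congr rfl fun j _ => by
    rw [(isGroupLike_iff.1 hS).2, (isGroupLike_iff.1 hT).2]

/-- In a finite sum over a rectangle, two families that agree off one point and have the same
total agree at that point. -/
theorem eq_of_sum_sum_eq {m n a b : ℕ} (ha : a ∈ Finset.range m) (hb : b ∈ Finset.range n)
    {f g : ℕ → ℕ → R}
    (h : ∑ i ∈ Finset.range m, ∑ j ∈ Finset.range n, f i j =
      ∑ i ∈ Finset.range m, ∑ j ∈ Finset.range n, g i j)
    (hfg : ∀ i ∈ Finset.range m, ∀ j ∈ Finset.range n, (i ≠ a ∨ j ≠ b) → f i j = g i j) :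
    f a b = g a b := by
  rw [← sub_eq_zero, ← Finset.sum_sub_distrib] at h
  rw [Finset.sum_eq_single_of_mem a ha, ← Finset.sum_sub_distrib,
    Finset.sum_eq_single_of_mem b hb] at h
  · exact sub_eq_zero.1 h
  · intro j hj hjb
    rw [hfg a ha j hj (Or.inr hjb), sub_self]
  · intro i hi hia
    rw [← Finset.sum_sub_distrib]
    exact Finset.sum_eq_zero fun j hj => by rw [hfg i hi j hj (Or.inl hia), sub_self]

/-- Induction on the total length of `u` and `v`. Both sides of the identity for `S * T` expand over
pairs of cuts, and every pair other than the full cut involves shorter prefixes, where the identity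
for `S` is known. The full cut is thus the only term left, and there `T` contributes 1. -/
theorem IsGroupLike.of_mul_right {S T : NCSeries R X} (hT : T.IsGroupLike)
    (hST : (S * T).IsGroupLike) : S.IsGroupLike := by
  have h1 : S.coeff [] = 1 := by
    have := hST.1
    rwa [coeff_mul_nil, hT.1, mul_one] at this
  refine isGroupLike_iff.2 ⟨h1, ?_⟩
  suffices H : ∀ n, ∀ u v : List X, u.length + v.length = n →
      shuffleCoeff S u v = S.coeff u * S.coeff v from fun u v => H _ u v rfl
  intro n
  induction n using Nat.strong_induction_on with
  | _ n ih =>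
    intro u v hn
    have h := (isGroupLike_iff.1 hST).2 u v
    rw [shuffleCoeff_mul, coeff_mul_coeff_mul] at h
    have h2 := eq_of_sum_sum_eq (a := u.length) (b := v.length) (by simp) (by simp) h ?_
    · simpa [hT.1] using h2
    · intro i hi j hj hij
      simp only [Finset.mem_range] at hi hj
      rw [(isGroupLike_iff.1 hT).2, ih _ _ _ _ rfl]
      rw [List.length_take, List.length_take]
      omega

/-- Mirror image of `IsGroupLike.of_mul_right`: the isolated term is the empty cut. -/
theorem IsGroupLike.of_mul_left {S T : NCSeries R X} (hS : S.IsGroupLike)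
    (hST : (S * T).IsGroupLike) : T.IsGroupLike := by
  have h1 : T.coeff [] = 1 := by
    have := hST.1
    rwa [coeff_mul_nil, hS.1, one_mul] at this
  refine isGroupLike_iff.2 ⟨h1, ?_⟩
  suffices H : ∀ n, ∀ u v : List X, u.length + v.length = n →
      shuffleCoeff T u v = T.coeff u * T.coeff v from fun u v => H _ u v rfl
  intro n
  induction n using Nat.strong_induction_on with
  | _ n ih =>
    intro u v hn
    have h := (isGroupLike_iff.1 hST).2 u v
    rw [shuffleCoeff_mul, coeff_mul_coeff_mul] at h
    have h2 := eq_of_sum_sum_eq (a := 0) (b := 0) (by simp) (by simp) h ?_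
    · simpa [hS.1] using h2
    · intro i hi j hj hij
      simp only [Finset.mem_range] at hi hj
      rw [(isGroupLike_iff.1 hS).2, ih _ _ _ _ rfl]
      rw [List.length_drop, List.length_drop]
      omega

end GroupLike

/-! ### Primitive series and Lie polynomials -/

section Primitive

variable {R X : Type*} [CommRing R]

/-- Primitive series for the shuffle coproduct. -/
def IsPrimitive (S : NCSeries R X) : Prop :=
  S.coeff [] = 0 ∧ ∀ u v : List X, u ≠ [] → v ≠ [] → shuffleCoeff S u v = 0

/-- The coproduct of `C` is `C ⊗ 1 + 1 ⊗ C`: among the pairs of prefixes, only those with exactly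
one of them empty contribute. -/
theorem IsPrimitive.shuffleCoeff_mul {C : NCSeries R X} (hC : C.IsPrimitive) (T : NCSeries R X)
    (u v : List X) :
    shuffleCoeff (C * T) u v =
      (∑ i ∈ Finset.range (u.length + 1), C.coeff (u.take i) * shuffleCoeff T (u.drop i) v) +
      ∑ j ∈ Finset.range (v.length + 1), C.coeff (v.take j) * shuffleCoeff T u (v.drop j) := by
  rw [NCSeries.shuffleCoeff_mul, Finset.sum_range_succ', Finset.sum_range_succ' _ u.length]
  simp only [List.take_zero, List.drop_zero, shuffleCoeff_nil_left, hC.1, zero_mul, add_zero]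
  congr 1
  refine Finset.sum_congr rfl fun i hi => ?_
  rw [Finset.sum_range_succ', Finset.sum_eq_zero, zero_add]
  · simp
  · intro j hj
    rw [Finset.mem_range] at hi hj
    rw [hC.2, zero_mul]
    · exact List.ne_nil_of_length_pos (by rw [List.length_take]; omega)
    · exact List.ne_nil_of_length_pos (by rw [List.length_take]; omega)

/-- The value is symmetric in `C` and `E`, so it cancels in the commutator; this makes the primitive
series a Lie algebra. -/
theorem IsPrimitive.shuffleCoeff_mul_self {C E : NCSeries R X} (hC : C.IsPrimitive)
    (hE : E.IsPrimitive) {u v : List X} (hu : u ≠ []) (hv : v ≠ []) :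
    shuffleCoeff (C * E) u v = C.coeff u * E.coeff v + C.coeff v * E.coeff u := by
  rw [hC.shuffleCoeff_mul, Finset.sum_range_succ, Finset.sum_range_succ,
    Finset.sum_eq_zero, Finset.sum_eq_zero]
  · simp
  · intro j hj
    rw [Finset.mem_range] at hj
    rw [hE.2 _ _ hu, mul_zero]
    exact List.ne_nil_of_length_pos (by rw [List.length_drop]; omega)
  · intro j hj
    rw [Finset.mem_range] at hj
    rw [hE.2 _ _ _ hv, mul_zero]
    exact List.ne_nil_of_length_pos (by rw [List.length_drop]; omega)

/-- The Lie subalgebra of primitive series. -/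
def primitives (R X : Type*) [CommRing R] : LieSubalgebra R (NCSeries R X) where
  carrier := {S | S.IsPrimitive}
  add_mem' := fun {a b} ha hb =>
    ⟨by rw [coeff_add, ha.1, hb.1, add_zero], fun u v hu hv => by
      rw [shuffleCoeff_add, ha.2 u v hu hv, hb.2 u v hu hv, add_zero]⟩
  zero_mem' := ⟨rfl, fun u v _ _ => shuffleCoeff_zero u v⟩
  smul_mem' := fun r a ha =>
    ⟨by rw [coeff_smul, ha.1, mul_zero], fun u v hu hv => by
      rw [shuffleCoeff_smul, ha.2 u v hu hv, mul_zero]⟩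
  lie_mem' := fun {a b} ha hb =>
    ⟨by
      change (a * b - b * a).coeff [] = 0
      rw [coeff_sub, coeff_mul_nil, coeff_mul_nil, mul_comm, sub_self], fun u v hu hv => by
      change shuffleCoeff (a * b - b * a) u v = 0
      rw [shuffleCoeff_sub, IsPrimitive.shuffleCoeff_mul_self ha hb hu hv,
        IsPrimitive.shuffleCoeff_mul_self hb ha hu hv]
      ring⟩

theorem isPrimitive_letter (x : X) : (letter R x).IsPrimitive := by
  refine ⟨by simp [letter], fun u v hu hv => shuffleCoeff_eq_zero fun w hw => ?_⟩
  have := hw.length_eq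
  have h1 := List.length_pos_iff.2 hu
  have h2 := List.length_pos_iff.2 hv
  rw [List.length_append] at this
  rw [letter, coeff_mk, if_neg]
  rintro rfl
  rw [List.length_singleton] at this
  omega

theorem isPrimitive_of_mem_liePolynomials {P : NCSeries R X} (hP : P ∈ liePolynomials R X) :
    P.IsPrimitive := by
  have : liePolynomials R X ≤ primitives R X := by
    rw [liePolynomials, LieSubalgebra.lieSpan_le]
    rintro _ ⟨x, rfl⟩
    exact isPrimitive_letter x
  exact this hP

theorem coeff_component_of_perm (S : NCSeries R X) {w u : List X} (h : w.Perm u) :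
    (S.component (u : Multiset X)).coeff w = S.coeff w := by
  rw [component, coeff_mk, if_pos (Multiset.coe_eq_coe.2 h)]

theorem coeff_component_of_ne (S : NCSeries R X) {w : List X} {m : Multiset X}
    (h : (w : Multiset X) ≠ m) : (S.component m).coeff w = 0 := by
  rw [component, coeff_mk, if_neg h]

/-- All words of a shuffle of `u` and `v` have the multidegree of `u ++ v`, so primitivity can be
tested on one component at a time. -/
theorem IsLieSeries.isPrimitive {S : NCSeries R X} (hS : S.IsLieSeries) : S.IsPrimitive := by
  constructor
  · have := (isPrimitive_of_mem_liePolynomials (hS (([] : List X) : Multiset X))).1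
    rwa [coeff_component_of_perm S (List.Perm.refl _)] at this
  · intro u v hu hv
    rw [← (isPrimitive_of_mem_liePolynomials (hS ((u ++ v : List X) : Multiset X))).2 u v hu hv]
    exact shuffleCoeff_congr fun w hw => (coeff_component_of_perm S hw).symm

theorem IsPrimitive.component {S : NCSeries R X} (hS : S.IsPrimitive) (m : Multiset X) :
    (S.component m).IsPrimitive := by
  by_cases h : ∃ w : List X, (w : Multiset X) = m
  swap
  · push Not at h
    exact ⟨coeff_component_of_ne S (h _), fun u v _ _ =>
      shuffleCoeff_eq_zero fun w _ => coeff_component_of_ne S (h _)⟩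
  obtain ⟨w₀, rfl⟩ := h
  constructor
  · by_cases h0 : (([] : List X) : Multiset X) = w₀
    · rw [coeff_component_of_perm S (Multiset.coe_eq_coe.1 h0), hS.1]
    · exact coeff_component_of_ne S h0
  · intro u v hu hv
    by_cases h0 : ((u ++ v : List X) : Multiset X) = w₀
    · rw [← hS.2 u v hu hv]
      exact shuffleCoeff_congr fun w hw =>
        coeff_component_of_perm S (hw.trans (Multiset.coe_eq_coe.1 h0))
    · exact shuffleCoeff_eq_zero fun w hw => coeff_component_of_ne S fun h =>
        h0 (by rw [← h]; exact (Multiset.coe_eq_coe.2 hw).symm)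

end Primitive

/-! ### Exponentials of primitive series -/

section Exp

variable {K X : Type*}

theorem coeff_pow_eq_zero [CommRing K] {C : NCSeries K X} (hC : C.coeff [] = 0) :
    ∀ (n : ℕ) (w : List X), w.length < n → (C ^ n).coeff w = 0
  | 0, w, h => absurd h (Nat.not_lt_zero _)
  | n + 1, w, h => by
    rw [pow_succ', coeff_mul]
    refine Finset.sum_eq_zero fun i hi => ?_
    rw [Finset.mem_range] at hi
    cases i with
    | zero => simp [hC]
    | succ i =>
      rw [coeff_pow_eq_zero hC n, mul_zero]
      rw [List.length_drop]
      omega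

variable [Field K]

/-- The divided powers `C ^ n / n!`. -/
noncomputable def dividedPow (C : NCSeries K X) (n : ℕ) : NCSeries K X :=
  (n.factorial : K)⁻¹ • C ^ n

theorem coeff_exp (C : NCSeries K X) (w : List X) :
    C.exp.coeff w = ∑ n ∈ Finset.range (w.length + 1), (C.dividedPow n).coeff w := rfl

theorem coeff_dividedPow_eq_zero {C : NCSeries K X} (hC : C.coeff [] = 0) {n : ℕ} {w : List X}
    (h : w.length < n) : (C.dividedPow n).coeff w = 0 := by
  rw [dividedPow, coeff_smul, coeff_pow_eq_zero hC n w h, mul_zero]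

theorem coeff_exp_of_le {C : NCSeries K X} (hC : C.coeff [] = 0) {w : List X} {n : ℕ}
    (h : w.length ≤ n) :
    C.exp.coeff w = ∑ k ∈ Finset.range (n + 1), (C.dividedPow k).coeff w := by
  rw [coeff_exp]
  refine Finset.sum_subset (Finset.range_mono (by omega)) fun k _ hk => ?_
  rw [Finset.mem_range] at hk
  exact coeff_dividedPow_eq_zero hC (by omega)

theorem dividedPow_zero (C : NCSeries K X) : C.dividedPow 0 = 1 := by
  simp [dividedPow]

theorem coeff_exp_nil (C : NCSeries K X) : C.exp.coeff [] = 1 := by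
  simp [coeff_exp, dividedPow_zero, coeff_one_nil]

variable [CharZero K]

theorem mul_dividedPow (C : NCSeries K X) (n : ℕ) :
    C * C.dividedPow n = ((n : K) + 1) • C.dividedPow (n + 1) := by
  rw [dividedPow, dividedPow, mul_smul_comm, smul_smul, ← pow_succ', Nat.factorial_succ]
  congr 1
  have : ((n : K) + 1) ≠ 0 := by exact_mod_cast Nat.succ_ne_zero n
  have h2 : (n.factorial : K) ≠ 0 := by exact_mod_cast n.factorial_ne_zero
  push_cast
  field_simp

/-- This is the binomial formula for `(C ⊗ 1 + 1 ⊗ C) ^ n / n!`. In the induction, multiplication by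
`C` raises one of the two exponents, with that new exponent as weight; after reindexing, the two
weights add up to `n + 1`. -/
theorem IsPrimitive.shuffleCoeff_dividedPow {C : NCSeries K X} (hC : C.IsPrimitive) (n : ℕ) :
    ∀ u v : List X, shuffleCoeff (C.dividedPow n) u v =
      ∑ p ∈ Finset.HasAntidiagonal.antidiagonal n, (C.dividedPow p.1).coeff u * (C.dividedPow p.2).coeff v := by
  induction n with
  | zero =>
    intro u v
    rw [Finset.Nat.antidiagonal_zero, Finset.sum_singleton, dividedPow_zero]
    cases u with
    | nil => simp [coeff_one_nil]
    | cons x u =>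
      rw [coeff_one_cons, zero_mul]
      refine shuffleCoeff_eq_zero fun w hw => ?_
      have := hw.length_eq
      rw [coeff_one, if_neg]
      simp only [List.cons_append, List.length_cons] at this
      omega
  | succ n ih =>
    intro u v
    have hn : ((n : K) + 1) ≠ 0 := by exact_mod_cast Nat.succ_ne_zero n
    have h1 := hC.shuffleCoeff_mul (C.dividedPow n) u v
    rw [mul_dividedPow, shuffleCoeff_smul] at h1
    apply mul_left_cancel₀ hn
    rw [h1]
    simp only [ih, Finset.mul_sum]
    rw [Finset.sum_comm, Finset.sum_comm (s := Finset.range (v.length + 1))]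
    have h2 : ∀ p : ℕ × ℕ, ∑ i ∈ Finset.range (u.length + 1), C.coeff (u.take i) *
        ((C.dividedPow p.1).coeff (u.drop i) * (C.dividedPow p.2).coeff v) =
        ((p.1 + 1 : ℕ) : K) * (C.dividedPow (p.1 + 1)).coeff u * (C.dividedPow p.2).coeff v := by
      intro p
      push_cast
      rw [← coeff_smul ((p.1 : K) + 1), ← mul_dividedPow, coeff_mul, Finset.sum_mul]
      exact Finset.sum_congr rfl fun i _ => by ring
    have h3 : ∀ p : ℕ × ℕ, ∑ j ∈ Finset.range (v.length + 1), C.coeff (v.take j) *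
        ((C.dividedPow p.1).coeff u * (C.dividedPow p.2).coeff (v.drop j)) =
        ((p.2 + 1 : ℕ) : K) * (C.dividedPow p.1).coeff u * (C.dividedPow (p.2 + 1)).coeff v := by
      intro p
      push_cast
      rw [mul_right_comm, ← coeff_smul ((p.2 : K) + 1), ← mul_dividedPow, coeff_mul, Finset.sum_mul]
      exact Finset.sum_congr rfl fun i _ => by ring
    simp only [h2, h3]
    have h4 := Finset.Nat.sum_antidiagonal_succ (n := n) (f := fun p : ℕ × ℕ =>
      (p.1 : K) * (C.dividedPow p.1).coeff u * (C.dividedPow p.2).coeff v)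
    have h5 := Finset.Nat.sum_antidiagonal_succ' (n := n) (f := fun p : ℕ × ℕ =>
      (p.2 : K) * (C.dividedPow p.1).coeff u * (C.dividedPow p.2).coeff v)
    simp only [Nat.cast_zero, zero_mul, zero_add] at h4 h5
    rw [← h4, ← h5, ← Finset.sum_add_distrib]
    refine Finset.sum_congr rfl fun p hp => ?_
    have : ((p.1 : K) + p.2) = n + 1 := by exact_mod_cast Finset.HasAntidiagonal.mem_antidiagonal.1 hp
    rw [← this]
    ring

theorem IsPrimitive.isGroupLike_exp {C : NCSeries K X} (hC : C.IsPrimitive) :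
    C.exp.IsGroupLike := by
  refine isGroupLike_iff.2 ⟨coeff_exp_nil C, fun u v => ?_⟩
  have h1 : shuffleCoeff C.exp u v = shuffleCoeff
      (∑ k ∈ Finset.range (u.length + v.length + 1), C.dividedPow k) u v := by
    refine shuffleCoeff_congr fun w hw => ?_
    rw [coeff_sum]
    exact coeff_exp_of_le hC.1 (by rw [hw.length_eq, List.length_append])
  rw [h1, shuffleCoeff_sum, coeff_exp, coeff_exp, Finset.sum_mul_sum, ← Finset.sum_product']
  simp only [hC.shuffleCoeff_dividedPow]
  rw [Finset.sum_sigma']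
  symm
  -- The rectangle `p.1 ≤ |u|`, `p.2 ≤ |v|` sits inside the triangle `p.1 + p.2 ≤ |u| + |v|`. The
  -- remaining pairs of the triangle have an exponent exceeding the length of its word and
  -- contribute zero.
  refine Finset.sum_of_injOn (fun p => ⟨p.1 + p.2, p⟩) ?_ ?_ ?_ ?_
  · intro p _ q _ h
    simpa using congrArg (fun s : (_ : ℕ) × (ℕ × ℕ) => s.2) h
  · intro p hp
    simp only [Finset.coe_product, Finset.coe_range, Set.mem_prod, Set.mem_Iio] at hp
    simp only [Finset.coe_sigma, Set.mem_sigma_iff, Finset.mem_coe, Finset.mem_range,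
      Finset.HasAntidiagonal.mem_antidiagonal, and_true]
    omega
  · rintro ⟨n, p⟩ hp hnot
    simp only [Finset.mem_sigma, Finset.mem_range, Finset.HasAntidiagonal.mem_antidiagonal] at hp
    by_cases h : u.length < p.1
    · rw [coeff_dividedPow_eq_zero hC.1 h, zero_mul]
    · rw [coeff_dividedPow_eq_zero hC.1 (n := p.2) (w := v), mul_zero]
      by_contra h'
      apply hnot
      refine ⟨p, ?_, by simp only [hp.2]⟩
      simp only [Finset.coe_product, Finset.coe_range, Set.mem_prod, Set.mem_Iio]
      omega
  · intro p _
    rfl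

end Exp

end NCSeries

namespace NCSeries

/-! ### Dynkin's operator and Friedrichs' criterion -/

section Dynkin

variable {R X : Type*} [CommRing R]

/-- The convolution of the identity with the antipode, evaluated on a word. -/
def antipodeSum (S : NCSeries R X) (w : List X) : R :=
  ∑ i ∈ Finset.range (w.length + 1),
    (-1) ^ (w.length - i) * shuffleCoeff S (w.take i) (w.drop i).reverse

/-- The adjoint of the Dynkin operator: the convolution of the length grading with the antipode,
evaluated on a word. -/
def dynkinSum (S : NCSeries R X) (w : List X) : R :=
  ∑ i ∈ Finset.range (w.length + 1),
    (-1) ^ (w.length - i) * (i : R) * shuffleCoeff S (w.take i) (w.drop i).reverse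

theorem antipodeSum_nil (S : NCSeries R X) : S.antipodeSum [] = S.coeff [] := by
  simp [antipodeSum]

theorem dynkinSum_nil (S : NCSeries R X) : S.dynkinSum [] = 0 := by
  simp [dynkinSum]

/-- The two ends of a nonempty word: `x :: w = w' ++ [y]`. Shuffling a prefix with the reversed
complementary suffix, the first letter is either the first or the last letter of the word. -/
theorem shuffleCoeff_take_drop_reverse (S : NCSeries R X) {x y : X} {w w' : List X}
    (h : x :: w = w' ++ [y]) {i : ℕ} (hi : i + 1 ≤ w.length) :
    shuffleCoeff S ((x :: w).take (i + 1)) ((x :: w).drop (i + 1)).reverse =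
      shuffleCoeff (residual x S) (w.take i) (w.drop i).reverse +
      shuffleCoeff (residual y S) (w'.take (i + 1)) (w'.drop (i + 1)).reverse := by
  have hl : w.length = w'.length := by simpa using congrArg List.length h
  have h1 : (x :: w).take (i + 1) = w'.take (i + 1) := by
    rw [h, List.take_append_of_le_length (by omega)]
  have h2 : (x :: w).drop (i + 1) = w'.drop (i + 1) ++ [y] := by
    rw [h, List.drop_append_of_le_length (by omega)]
  have h3 : w.drop i = w'.drop (i + 1) ++ [y] := by rw [← h2, List.drop_succ_cons]
  rw [← h1, h3, h2, List.reverse_append, List.reverse_singleton, List.singleton_append,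
    List.take_succ_cons, shuffleCoeff_cons_cons]

theorem shuffleCoeff_reverse (S : NCSeries R X) {x y : X} {w w' : List X}
    (h : x :: w = w' ++ [y]) :
    shuffleCoeff S ((x :: w).take 0) ((x :: w).drop 0).reverse =
      shuffleCoeff (residual y S) (w'.take 0) (w'.drop 0).reverse := by
  simp [h]

theorem shuffleCoeff_take_length (S : NCSeries R X) (x : X) (w : List X) :
    shuffleCoeff S ((x :: w).take (w.length + 1)) ((x :: w).drop (w.length + 1)).reverse =
      shuffleCoeff (residual x S) (w.take w.length) (w.drop w.length).reverse := by
  simp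

/-- Here `a` collects the shuffles starting with the first letter of the word and `b` those starting
with its last letter. Removing the first letter keeps the sign and shifts the weight; removing the
last one changes the sign and keeps the weight. The weights `1` and `i` give the recursions of
`antipodeSum` and `dynkinSum`. -/
theorem weighted_sum_recursion {n : ℕ} {f a b c : ℕ → R}
    (h0 : f 0 = b 0) (hn : f (n + 1) = a n) (h : ∀ i < n, f (i + 1) = a i + b (i + 1)) :
    ∑ i ∈ Finset.range (n + 2), (-1) ^ (n + 1 - i) * c i * f i =
      ∑ i ∈ Finset.range (n + 1), (-1) ^ (n - i) * c (i + 1) * a i -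
        ∑ i ∈ Finset.range (n + 1), (-1) ^ (n - i) * c i * b i := by
  rw [Finset.sum_range_succ' _ (n + 1), Finset.sum_range_succ _ n,
    Finset.sum_range_succ (fun i => (-1) ^ (n - i) * c (i + 1) * a i) n,
    Finset.sum_range_succ' (fun i => (-1) ^ (n - i) * c i * b i) n, h0, hn]
  have h1 : ∀ i ∈ Finset.range n, (-1) ^ (n + 1 - (i + 1)) * c (i + 1) * f (i + 1) =
      (-1) ^ (n - i) * c (i + 1) * a i - (-1) ^ (n - (i + 1)) * c (i + 1) * b (i + 1) := by
    intro i hi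
    have hi := Finset.mem_range.1 hi
    rw [h i hi, Nat.add_sub_add_right, show n - i = n - (i + 1) + 1 by omega, pow_succ]
    ring
  rw [Finset.sum_congr rfl h1, Finset.sum_sub_distrib]
  simp only [Nat.sub_self, Nat.sub_zero, pow_succ, pow_zero]
  ring

theorem antipodeSum_cons (S : NCSeries R X) {x y : X} {w w' : List X} (h : x :: w = w' ++ [y]) :
    S.antipodeSum (x :: w) = (residual x S).antipodeSum w - (residual y S).antipodeSum w' := by
  have hl : w'.length = w.length := by simpa using (congrArg List.length h).symm
  have := weighted_sum_recursion (n := w.length) (c := fun _ => (1 : R))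
    (f := fun i => shuffleCoeff S ((x :: w).take i) ((x :: w).drop i).reverse)
    (a := fun i => shuffleCoeff (residual x S) (w.take i) (w.drop i).reverse)
    (b := fun i => shuffleCoeff (residual y S) (w'.take i) (w'.drop i).reverse)
    (shuffleCoeff_reverse S h) (shuffleCoeff_take_length S x w)
    (fun i hi => shuffleCoeff_take_drop_reverse S h hi)
  simpa [antipodeSum, hl] using this

theorem dynkinSum_cons (S : NCSeries R X) {x y : X} {w w' : List X} (h : x :: w = w' ++ [y]) :
    S.dynkinSum (x :: w) = (residual x S).dynkinSum w + (residual x S).antipodeSum w -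
      (residual y S).dynkinSum w' := by
  have hl : w'.length = w.length := by simpa using (congrArg List.length h).symm
  have := weighted_sum_recursion (n := w.length) (c := fun i => (i : R))
    (f := fun i => shuffleCoeff S ((x :: w).take i) ((x :: w).drop i).reverse)
    (a := fun i => shuffleCoeff (residual x S) (w.take i) (w.drop i).reverse)
    (b := fun i => shuffleCoeff (residual y S) (w'.take i) (w'.drop i).reverse)
    (shuffleCoeff_reverse S h) (shuffleCoeff_take_length S x w)
    (fun i hi => shuffleCoeff_take_drop_reverse S h hi)
  rw [dynkinSum, dynkinSum, dynkinSum, antipodeSum, hl, List.length_cons, this,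
    ← Finset.sum_add_distrib]
  congr 1
  refine Finset.sum_congr rfl fun i _ => ?_
  push_cast
  ring

theorem exists_eq_append_singleton (x : X) (w : List X) : ∃ w' y, x :: w = w' ++ [y] :=
  ⟨(x :: w).dropLast, (x :: w).getLast (List.cons_ne_nil x w),
    (List.dropLast_append_getLast (List.cons_ne_nil x w)).symm⟩

/-- The antipode is the convolution inverse of the identity. For a single letter both ends coincide
and cancel; for longer words both terms of the recursion vanish by induction. -/
theorem antipodeSum_cons_eq_zero : ∀ (n : ℕ) (S : NCSeries R X) (x : X) (w : List X),
    w.length = n → S.antipodeSum (x :: w) = 0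
  | 0, S, x, w, hw => by
    rw [List.length_eq_zero_iff] at hw
    subst hw
    rw [antipodeSum_cons S (x := x) (y := x) (w := []) (w' := []) rfl, sub_self]
  | n + 1, S, x, w, hw => by
    obtain ⟨w', y, h⟩ := exists_eq_append_singleton x w
    have hl : w'.length = n + 1 := by
      rw [← hw]
      simpa using (congrArg List.length h).symm
    rw [antipodeSum_cons S h]
    obtain ⟨a, v, rfl⟩ := List.exists_cons_of_length_eq_add_one hw
    obtain ⟨b, v', rfl⟩ := List.exists_cons_of_length_eq_add_one hl
    rw [antipodeSum_cons_eq_zero n _ _ _ (by simpa using hw),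
      antipodeSum_cons_eq_zero n _ _ _ (by simpa using hl), sub_self]

/-- The series with coefficients `dynkinSum S`. -/
def dynkin (S : NCSeries R X) : NCSeries R X := mk S.dynkinSum

/-- Proper cuts pair `P` with a shuffle of two nonempty words, and the empty prefix has weight zero;
only the full prefix remains. -/
theorem IsPrimitive.coeff_dynkin {P : NCSeries R X} (hP : P.IsPrimitive) (w : List X) :
    P.dynkin.coeff w = (w.length : R) * P.coeff w := by
  rw [dynkin, coeff_mk, dynkinSum, Finset.sum_range_succ, Finset.sum_eq_zero]
  · simp
  · intro i hi
    rw [Finset.mem_range] at hi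
    cases i with
    | zero => simp
    | succ i =>
      rw [hP.2, mul_zero]
      · exact List.ne_nil_of_length_pos (by rw [List.length_take]; omega)
      · exact List.ne_nil_of_length_pos (by rw [List.length_reverse, List.length_drop]; omega)

theorem dynkin_add (S T : NCSeries R X) : (S + T).dynkin = S.dynkin + T.dynkin := by
  ext w
  simp [dynkin, dynkinSum, mul_add, Finset.sum_add_distrib]

theorem dynkin_smul (r : R) (S : NCSeries R X) : (r • S).dynkin = r • S.dynkin := by
  ext w
  simp only [dynkin, dynkinSum, coeff_mk, coeff_smul, shuffleCoeff_smul, Finset.mul_sum]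
  exact Finset.sum_congr rfl fun i _ => by ring

/-- `dynkin` as a linear map. -/
def dynkinHom (R X : Type*) [CommRing R] : NCSeries R X →ₗ[R] NCSeries R X where
  toFun := dynkin
  map_add' := dynkin_add
  map_smul' := dynkin_smul

open Classical in
/-- The word `v`, as a series. -/
noncomputable def word (R : Type*) {X : Type*} [CommRing R] (v : List X) : NCSeries R X :=
  mk fun w => if w = v then 1 else 0

theorem residual_word_cons_self (x : X) (v : List X) :
    residual x (word R (x :: v)) = word R v := by
  ext w
  by_cases h : w = v <;> simp [word, h]

theorem residual_word_cons_of_ne {x z : X} (h : x ≠ z) (v : List X) :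
    residual x (word R (z :: v)) = 0 := by
  ext w
  simp [word, h]

theorem coeff_letter_mul_nil (z : X) (T : NCSeries R X) : (letter R z * T).coeff [] = 0 := by
  simp [coeff_mul_nil, letter]

theorem coeff_letter_mul_cons_self (z : X) (T : NCSeries R X) (w : List X) :
    (letter R z * T).coeff (z :: w) = T.coeff w := by
  have h : residual z (letter R z) = (1 : NCSeries R X) := by
    ext v
    cases v <;> simp [letter, coeff_one]
  rw [← coeff_residual, residual_mul, h, one_mul]
  simp [letter]

theorem coeff_letter_mul_cons_of_ne {x z : X} (h : x ≠ z) (T : NCSeries R X) (w : List X) :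
    (letter R z * T).coeff (x :: w) = 0 := by
  have h : residual x (letter R z) = (0 : NCSeries R X) := by
    ext v
    simp [letter, h]
  rw [← coeff_residual, residual_mul, h, zero_mul]
  simp [letter]

open Classical in
theorem coeff_mul_letter (z : X) (T : NCSeries R X) (w : List X) (y : X) :
    (T * letter R z).coeff (w ++ [y]) = if y = z then T.coeff w else 0 := by
  rw [coeff_mul, Finset.sum_eq_single w.length]
  · simp [letter]
  · intro i hi hne
    rw [letter, coeff_mk, if_neg, mul_zero]
    intro h
    have := congrArg List.length h
    simp only [List.length_drop, List.length_append, List.length_singleton] at this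
    omega
  · simp

theorem dynkin_word_nil : (word R ([] : List X)).dynkin = 0 := by
  ext w
  cases w with
  | nil => exact dynkinSum_nil _
  | cons x w =>
    obtain ⟨w', y, h⟩ := exists_eq_append_singleton x w
    have hr : ∀ z : X, residual z (word R ([] : List X)) = 0 := fun z => by
      ext v
      simp [word]
    rw [dynkin, coeff_mk, dynkinSum_cons _ h, hr, hr]
    simp [dynkinSum, antipodeSum]

open Classical in
-- The three terms of `dynkinSum_cons` become left multiplication by `z`, a correction at the word
-- `z` alone (the antipode sum survives only at the empty word), and right multiplication by `z`.
-- Iterating yields right-nested brackets.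
theorem dynkin_word_cons (z : X) (v : List X) :
    (word R (z :: v)).dynkin = ⁅letter R z, (word R v).dynkin⁆ +
      if v = [] then letter R z else 0 := by
  change _ = letter R z * (word R v).dynkin - (word R v).dynkin * letter R z + _
  have hzero : ∀ w, (0 : NCSeries R X).dynkinSum w = 0 ∧
      (0 : NCSeries R X).antipodeSum w = 0 := fun w => by
    simp [dynkinSum, antipodeSum]
  have hanti : ∀ (x : X) (w : List X), (word R v).antipodeSum w =
      (if v = [] then letter R z else 0).coeff (z :: w) := by
    intro x w
    cases w with
    | nil => by_cases hv : v = [] <;> simp [antipodeSum_nil, word, letter, hv, eq_comm]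
    | cons a w =>
      rw [antipodeSum_cons_eq_zero _ _ _ _ rfl]
      by_cases hv : v = [] <;> simp [letter, hv]
  ext w
  cases w with
  | nil =>
    rw [dynkin, coeff_mk, dynkinSum_nil, coeff_add, coeff_sub, coeff_letter_mul_nil,
      coeff_mul_nil]
    by_cases hv : v = [] <;> simp [hv, letter]
  | cons x w =>
    obtain ⟨w', y, h⟩ := exists_eq_append_singleton x w
    have hb : ((word R v).dynkin * letter R z).coeff (x :: w) =
        (residual y (word R (z :: v))).dynkinSum w' := by
      rw [h, coeff_mul_letter]
      split_ifs with hy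
      · rw [hy, residual_word_cons_self, dynkin, coeff_mk]
      · rw [residual_word_cons_of_ne hy, (hzero _).1]
    rw [dynkin, coeff_mk, dynkinSum_cons _ h, coeff_add, coeff_sub, hb]
    by_cases hx : x = z
    · subst hx
      rw [residual_word_cons_self, coeff_letter_mul_cons_self, hanti x w, dynkin, coeff_mk]
      ring
    · rw [residual_word_cons_of_ne hx, (hzero _).1, (hzero _).2, coeff_letter_mul_cons_of_ne hx]
      have : (if v = [] then letter R z else 0 : NCSeries R X).coeff (x :: w) = 0 := by
        by_cases hv : v = [] <;> simp [letter, hv, hx]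
      rw [this]
      ring

theorem dynkin_word_mem (v : List X) : (word R v).dynkin ∈ liePolynomials R X := by
  have hl : ∀ z : X, letter R z ∈ liePolynomials R X := fun z =>
    LieSubalgebra.subset_lieSpan ⟨z, rfl⟩
  induction v with
  | nil => rw [dynkin_word_nil]; exact zero_mem _
  | cons z v ih =>
    classical
    rw [dynkin_word_cons]
    refine add_mem (LieSubalgebra.lie_mem _ (hl z) ih) ?_
    split_ifs
    · exact hl z
    · exact zero_mem _

/-- A multidegree contains only the permutations of one word, so components are finite sums even
over an infinite alphabet, and linearity reduces `dynkin` to words. -/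
theorem exists_component_eq_sum (S : NCSeries R X) (m : Multiset X) :
    ∃ s : Finset (List X), S.component m = ∑ v ∈ s, S.coeff v • word R v := by
  classical
  obtain ⟨l, rfl⟩ : ∃ l : List X, (l : Multiset X) = m := Quotient.exists_rep m
  refine ⟨l.permutations.toFinset, ext fun w => ?_⟩
  rw [coeff_sum]
  by_cases h : w.Perm l
  · rw [Finset.sum_eq_single w]
    · rw [coeff_component_of_perm S h]
      simp [word]
    · intro v _ hv
      simp [word, hv.symm]
    · simp [h]
  · rw [coeff_component_of_ne S (fun h' => h (Multiset.coe_eq_coe.1 h')),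
      Finset.sum_eq_zero]
    intro v hv
    have : w ≠ v := by
      rintro rfl
      exact h (by simpa using hv)
    simp [word, this]

/-- Friedrichs' criterion: primitive series over a field of characteristic zero are Lie series. -/
theorem IsPrimitive.isLieSeries {K : Type*} [Field K] [CharZero K] {P : NCSeries K X}
    (hP : P.IsPrimitive) : P.IsLieSeries := by
  intro m
  have hPm := hP.component m
  have h1 : (P.component m).dynkin = (m.card : K) • P.component m := by
    ext w
    rw [hPm.coeff_dynkin, coeff_smul]
    by_cases h : (w : Multiset X) = m
    · rw [← h, Multiset.coe_card]
    · rw [coeff_component_of_ne P h, mul_zero, mul_zero]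
  have h2 : (P.component m).dynkin ∈ liePolynomials K X := by
    obtain ⟨s, hs⟩ := exists_component_eq_sum P m
    rw [hs]
    change dynkinHom K X _ ∈ _
    rw [map_sum]
    refine sum_mem fun v _ => ?_
    rw [map_smul]
    exact (liePolynomials K X).smul_mem _ (dynkin_word_mem v)
  -- Division by the degree is impossible in degree zero, where the component of a primitive series
  -- vanishes anyway.
  by_cases hm : m.card = 0
  · rw [Multiset.card_eq_zero] at hm
    have : P.component m = 0 := by
      ext w
      by_cases h : (w : Multiset X) = m
      · rw [hm, Multiset.coe_eq_zero] at h
        rw [h, hPm.1, coeff_zero]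
      · rw [coeff_component_of_ne P h, coeff_zero]
    rw [this]
    exact zero_mem _
  · have hm' : (m.card : K) ≠ 0 := by exact_mod_cast hm
    have h3 := (liePolynomials K X).smul_mem (m.card : K)⁻¹ h2
    rwa [h1, smul_smul, inv_mul_cancel₀ hm', one_smul] at h3

end Dynkin

end NCSeries

namespace NCSeries

/-! ### Truncation and division of series -/

section Truncation

variable {R X : Type*} [CommRing R]

/-- Agreement of two series on all words of length at most `n`. -/
def AgreeUpTo (n : ℕ) (S T : NCSeries R X) : Prop :=
  ∀ w : List X, w.length ≤ n → S.coeff w = T.coeff w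

theorem AgreeUpTo.mul {n : ℕ} {S S' T T' : NCSeries R X} (hS : AgreeUpTo n S S')
    (hT : AgreeUpTo n T T') : AgreeUpTo n (S * T) (S' * T') := by
  intro w hw
  rw [coeff_mul, coeff_mul]
  refine Finset.sum_congr rfl fun i _ => ?_
  rw [hS _ (by rw [List.length_take]; omega), hT _ (by rw [List.length_drop]; omega)]

/-- Without constant terms, only proper cuts contribute, and both pieces of a word of length `n + 1`
then have length at most `n`. -/
theorem AgreeUpTo.mul_succ {n : ℕ} {S S' T T' : NCSeries R X} (hS : AgreeUpTo n S S')
    (hT : AgreeUpTo n T T') (hS0 : S.coeff [] = 0) (hS0' : S'.coeff [] = 0)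
    (hT0 : T.coeff [] = 0) (hT0' : T'.coeff [] = 0) :
    AgreeUpTo (n + 1) (S * T) (S' * T') := by
  intro w hw
  rw [coeff_mul, coeff_mul]
  refine Finset.sum_congr rfl fun i hi => ?_
  rw [Finset.mem_range] at hi
  by_cases h0 : i = 0
  · simp [h0, hS0, hS0']
  by_cases h1 : i = w.length
  · simp [h1, hT0, hT0']
  rw [hS _ (by rw [List.length_take]; omega), hT _ (by rw [List.length_drop]; omega)]

theorem coeff_pow_succ_nil {S : NCSeries R X} (hS : S.coeff [] = 0) (k : ℕ) :
    (S ^ (k + 1)).coeff [] = 0 := by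
  rw [pow_succ, coeff_mul_nil, hS, mul_zero]

theorem AgreeUpTo.pow {n : ℕ} {S S' : NCSeries R X} (hS : AgreeUpTo n S S') :
    ∀ k : ℕ, AgreeUpTo n (S ^ k) (S' ^ k)
  | 0 => fun w _ => by simp
  | k + 1 => by
    rw [pow_succ, pow_succ]
    exact (AgreeUpTo.pow hS k).mul hS

/-- Left multiplication by a series with constant term one is injective. -/
theorem eq_zero_of_mul_eq_zero_left {S T : NCSeries R X} (hS : S.coeff [] = 1)
    (h : S * T = 0) : T = 0 := by
  suffices H : ∀ n, ∀ w : List X, w.length = n → T.coeff w = 0 from ext fun w => H _ w rfl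
  intro n
  induction n using Nat.strong_induction_on with
  | _ n ih =>
    intro w hw
    have h1 : (S * T).coeff w = 0 := by rw [h, coeff_zero]
    rw [coeff_mul, Finset.sum_eq_single 0] at h1
    · simpa [hS] using h1
    · intro i hi hi0
      rw [Finset.mem_range] at hi
      rw [ih _ _ _ rfl, mul_zero]
      rw [List.length_drop]
      omega
    · simp

/-- Right multiplication by a series with constant term one is injective. -/
theorem eq_zero_of_mul_eq_zero_right {S T : NCSeries R X} (hT : T.coeff [] = 1)
    (h : S * T = 0) : S = 0 := by
  suffices H : ∀ n, ∀ w : List X, w.length = n → S.coeff w = 0 from ext fun w => H _ w rfl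
  intro n
  induction n using Nat.strong_induction_on with
  | _ n ih =>
    intro w hw
    have h1 : (S * T).coeff w = 0 := by rw [h, coeff_zero]
    rw [coeff_mul, Finset.sum_eq_single w.length] at h1
    · simpa [hT] using h1
    · intro i hi hi0
      rw [Finset.mem_range] at hi
      rw [ih _ _ _ rfl, zero_mul]
      rw [List.length_take]
      omega
    · simp

/-- A series with constant term one divides every series on the left. -/
theorem exists_mul_eq {H : NCSeries R X} (hH : H.coeff [] = 1) (S : NCSeries R X) :
    ∃ T : NCSeries R X, H * T = S := by
  set N : NCSeries R X := 1 - H with hN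
  have hN0 : N.coeff [] = 0 := by rw [hN, coeff_sub, coeff_one_nil, hH, sub_self]
  have hHN : H = 1 - N := by rw [hN, sub_sub_cancel]
  have hzero : ∀ (k : ℕ) (w : List X), w.length < k → (N ^ k * S).coeff w = 0 := by
    intro k w hw
    rw [coeff_mul]
    refine Finset.sum_eq_zero fun i _ => ?_
    rw [coeff_pow_eq_zero hN0 k, zero_mul]
    rw [List.length_take]
    omega
  let P : ℕ → NCSeries R X := fun n => ∑ k ∈ Finset.range (n + 1), N ^ k * S
  -- The quotient is the geometric series `∑ N ^ k * S`; at a word, only the exponents up to its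
  -- length matter.
  refine ⟨mk fun w => (P w.length).coeff w, ext fun w => ?_⟩
  have hagree : AgreeUpTo w.length (mk fun w => (P w.length).coeff w) (P w.length) := by
    intro v hv
    rw [coeff_mk, coeff_sum, coeff_sum]
    refine Finset.sum_subset (Finset.range_mono (by omega)) fun k _ hk => ?_
    rw [Finset.mem_range] at hk
    exact hzero k v (by omega)
  have hgeom : H * P w.length = S - N ^ (w.length + 1) * S := by
    change H * ∑ k ∈ Finset.range (w.length + 1), N ^ k * S = _
    rw [← Finset.sum_mul, ← mul_assoc, hHN, mul_neg_geom_sum, sub_mul, one_mul]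
  rw [AgreeUpTo.mul (fun _ _ => rfl) hagree w le_rfl, hgeom, coeff_sub,
    hzero _ _ (Nat.lt_succ_self _), sub_zero]

end Truncation

/-! ### Logarithms of group-like series -/

section Logarithm

variable {K X : Type*} [Field K]

theorem AgreeUpTo.exp {n : ℕ} {C C' : NCSeries K X} (h : AgreeUpTo n C C') :
    AgreeUpTo n C.exp C'.exp := by
  intro w hw
  rw [coeff_exp, coeff_exp]
  refine Finset.sum_congr rfl fun k _ => ?_
  rw [dividedPow, dividedPow, coeff_smul, coeff_smul, h.pow k w hw]

/-- The exponential is tangent to the identity: it transports differences in lowest degree. -/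
theorem AgreeUpTo.coeff_exp_sub {n : ℕ} {C C' : NCSeries K X} (h : AgreeUpTo n C C')
    (hC : C.coeff [] = 0) (hC' : C'.coeff [] = 0) {w : List X} (hw : w.length = n + 1) :
    C.exp.coeff w - C'.exp.coeff w = C.coeff w - C'.coeff w := by
  rw [coeff_exp, coeff_exp, ← Finset.sum_sub_distrib, Finset.sum_eq_single 1]
  · simp [dividedPow]
  · intro k _ hk
    cases k with
    | zero => rw [dividedPow_zero, dividedPow_zero, sub_self]
    | succ k =>
      cases k with
      | zero => exact absurd rfl hk
      | succ k =>
        -- Powers with exponent at least 2 agree one degree further, so the linear term alone sees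
        -- the difference in length `n + 1`.
        rw [dividedPow, dividedPow, coeff_smul, coeff_smul, pow_succ, pow_succ C',
          (h.pow (k + 1)).mul_succ h (coeff_pow_succ_nil hC k) (coeff_pow_succ_nil hC' k)
            hC hC' w hw.le, sub_self]
  · intro h1
    rw [Finset.mem_range] at h1
    omega

/-- Successive approximations of the logarithm of a series. -/
noncomputable def logApprox (T : NCSeries K X) : ℕ → NCSeries K X
  | 0 => 0
  | n + 1 => logApprox T n +
      mk fun w => if w.length = n + 1 then T.coeff w - (logApprox T n).exp.coeff w else 0

theorem agreeUpTo_logApprox_succ (T : NCSeries K X) (n : ℕ) :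
    AgreeUpTo n (logApprox T (n + 1)) (logApprox T n) := by
  intro w hw
  rw [logApprox, coeff_add, coeff_mk, if_neg (by omega), add_zero]

theorem agreeUpTo_logApprox (T : NCSeries K X) {n m : ℕ} (h : n ≤ m) :
    AgreeUpTo n (logApprox T m) (logApprox T n) := by
  induction m, h using Nat.le_induction with
  | base => exact fun _ _ => rfl
  | succ m hm ih =>
    intro w hw
    rw [agreeUpTo_logApprox_succ T m w (by omega), ih w hw]

theorem coeff_logApprox_nil (T : NCSeries K X) (n : ℕ) : (logApprox T n).coeff [] = 0 :=
  agreeUpTo_logApprox T (Nat.zero_le n) [] le_rfl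

theorem agreeUpTo_exp_logApprox {T : NCSeries K X} (hT : T.coeff [] = 1) :
    ∀ n, AgreeUpTo n (logApprox T n).exp T
  | 0 => fun w hw => by
    rw [Nat.le_zero, List.length_eq_zero_iff] at hw
    rw [hw, coeff_exp_nil, hT]
  | n + 1 => fun w hw => by
    rcases Nat.lt_or_ge n w.length with h | h
    · have hl : w.length = n + 1 := by omega
      have := (agreeUpTo_logApprox_succ T n).coeff_exp_sub (coeff_logApprox_nil T _)
        (coeff_logApprox_nil T _) hl
      rw [logApprox, coeff_add, coeff_mk, if_pos hl, add_sub_cancel_left, ← logApprox] at this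
      exact sub_left_injective this
    · rw [(agreeUpTo_logApprox_succ T n).exp w h, agreeUpTo_exp_logApprox hT n w h]

/-- The correction in degree `n + 1` is the difference of two group-like series agreeing up to
length `n`. On a shuffle of nonempty words of total length `n + 1`, both take the same product of
values at words of length at most `n`. -/
theorem isPrimitive_logApprox [CharZero K] {T : NCSeries K X} (hT : T.IsGroupLike) :
    ∀ n, (logApprox T n).IsPrimitive
  | 0 => ⟨rfl, fun u v _ _ => shuffleCoeff_zero u v⟩
  | n + 1 => by
    have ih := isPrimitive_logApprox hT n
    refine ⟨coeff_logApprox_nil T _, fun u v hu hv => ?_⟩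
    rw [logApprox, shuffleCoeff_add, ih.2 u v hu hv, zero_add]
    by_cases h : u.length + v.length = n + 1
    · have h1 : shuffleCoeff (mk fun w => if w.length = n + 1 then
          T.coeff w - (logApprox T n).exp.coeff w else 0) u v =
          shuffleCoeff (T - (logApprox T n).exp) u v := by
        refine shuffleCoeff_congr fun w hw => ?_
        rw [coeff_mk, if_pos (by rw [hw.length_eq, List.length_append, h]), coeff_sub]
      have hu' := List.length_pos_iff.2 hu
      have hv' := List.length_pos_iff.2 hv
      rw [h1, shuffleCoeff_sub, (isGroupLike_iff.1 hT).2,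
        (isGroupLike_iff.1 ih.isGroupLike_exp).2, agreeUpTo_exp_logApprox hT.1 n u (by omega),
        agreeUpTo_exp_logApprox hT.1 n v (by omega), sub_self]
    · refine shuffleCoeff_eq_zero fun w hw => ?_
      rw [coeff_mk, if_neg]
      rw [hw.length_eq, List.length_append]
      exact h

/-- A group-like series over a field of characteristic zero is the exponential of a primitive
series. -/
theorem IsGroupLike.exists_exp_eq [CharZero K] {T : NCSeries K X} (hT : T.IsGroupLike) :
    ∃ C : NCSeries K X, C.IsPrimitive ∧ C.exp = T := by
  let C : NCSeries K X := mk fun w => (logApprox T w.length).coeff w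
  have hC : ∀ n, AgreeUpTo n C (logApprox T n) := fun n w hw =>
    (agreeUpTo_logApprox T hw w le_rfl).symm
  refine ⟨C, ⟨rfl, fun u v hu hv => ?_⟩, ext fun w => ?_⟩
  · rw [← (isPrimitive_logApprox hT (u.length + v.length)).2 u v hu hv]
    refine shuffleCoeff_congr fun w hw => hC _ w ?_
    rw [hw.length_eq, List.length_append]
  · rw [(hC w.length).exp w le_rfl, agreeUpTo_exp_logApprox hT.1 _ w le_rfl]

end Logarithm

/-! ### Comparison of solutions: assertion 1 -/

section Solutions

@[simp] theorem coeff_map {R X T : Type*} (f : R → T) (S : NCSeries R X) (w : List X) :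
    (S.map f).coeff w = f (S.coeff w) := rfl

variable {k R X : Type*} [CommRing k] [CommRing R] [Algebra k R]

@[simp] theorem coeff_deriv (D : Derivation k R R) (S : NCSeries R X) (w : List X) :
    (S.deriv D).coeff w = D (S.coeff w) := rfl

theorem deriv_mul (D : Derivation k R R) (S T : NCSeries R X) :
    (S * T).deriv D = S.deriv D * T + S * T.deriv D := by
  ext w
  simp only [coeff_deriv, coeff_mul, coeff_add, map_sum, ← Finset.sum_add_distrib,
    Derivation.leibniz, smul_eq_mul]
  exact Finset.sum_congr rfl fun i _ => by ring

theorem deriv_map_algebraMap (D : Derivation k R R) (T : NCSeries k X) :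
    (T.map (algebraMap k R)).deriv D = 0 := by
  ext w
  simp

theorem shuffleCoeff_map {T : Type*} [CommRing T] (f : R →+* T) (S : NCSeries R X)
    (u v : List X) : shuffleCoeff (S.map f) u v = f (shuffleCoeff S u v) := by
  rw [shuffleCoeff, shuffleCoeff, map_list_sum, List.map_map]
  rfl

theorem isGroupLike_map_iff {T : Type*} [CommRing T] {f : R →+* T} (hf : Function.Injective f)
    {S : NCSeries R X} : (S.map f).IsGroupLike ↔ S.IsGroupLike := by
  simp only [isGroupLike_iff, shuffleCoeff_map, coeff_map, ← map_mul, hf.eq_iff,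
    map_eq_one_iff f hf]

/-- The right factor has derivative zero, so the equation reads `(𝐝H - MH) T = 0`, and `T` can be
cancelled. -/
theorem IsSolution.of_mul_map {D : Derivation k R R} {u : X → R} {H : NCSeries R X}
    {T : NCSeries k X} (hT : T.coeff [] = 1)
    (h : (H * T.map (algebraMap k R)).IsSolution D u) : H.IsSolution D u := by
  have hT' : (T.map (algebraMap k R)).coeff [] = 1 := by rw [coeff_map, hT, map_one]
  constructor
  · have h1 := h.1
    rw [deriv_mul, deriv_map_algebraMap, mul_zero, add_zero, ← mul_assoc, ← sub_eq_zero,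
      ← sub_mul] at h1
    exact sub_eq_zero.1 (eq_zero_of_mul_eq_zero_right hT' h1)
  · have h2 := h.2
    rwa [coeff_mul_nil, hT', mul_one] at h2

/-- Two solutions differ by a right factor with constant coefficients. -/
theorem IsSolution.exists_mul_map_eq {D : Derivation k R R} {u : X → R}
    (hD : ∀ a : R, D a = 0 → ∃ c : k, algebraMap k R c = a) {S H : NCSeries R X}
    (hS : S.IsSolution D u) (hH : H.IsSolution D u) :
    ∃ T : NCSeries k X, S = H * T.map (algebraMap k R) := by
  obtain ⟨T, rfl⟩ := exists_mul_eq hH.2 S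
  have h1 := hS.1
  rw [deriv_mul, hH.1, mul_assoc, add_eq_left] at h1
  have h2 := eq_zero_of_mul_eq_zero_left hH.2 h1
  have h3 : ∀ w, ∃ c : k, algebraMap k R c = T.coeff w := fun w =>
    hD _ (by rw [← coeff_deriv, h2, coeff_zero])
  choose c hc using h3
  refine ⟨mk c, ?_⟩
  congr 1
  ext w
  exact (hc w).symm

theorem isGroupLike_and_isSolution_iff {F R X : Type*} [Field F] [CharZero F] [CommRing R]
    [Nontrivial R] [Algebra F R] {D : Derivation F R R} {u : X → R}
    (hD : ∀ a : R, D a = 0 → ∃ c : F, algebraMap F R c = a) {S : NCSeries R X}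
    (hS : S.IsGroupLike) (hSol : S.IsSolution D u) (H : NCSeries R X) :
    (H.IsGroupLike ∧ H.IsSolution D u) ↔
      ∃ C : NCSeries F X, C.IsLieSeries ∧ S = H * C.exp.map (algebraMap F R) := by
  have hinj := FaithfulSMul.algebraMap_injective F R
  constructor
  · rintro ⟨hH, hHSol⟩
    obtain ⟨T, rfl⟩ := hSol.exists_mul_map_eq hD hHSol
    have hT : T.IsGroupLike := (isGroupLike_map_iff hinj).1 (hH.of_mul_left hS)
    obtain ⟨C, hC, rfl⟩ := hT.exists_exp_eq
    exact ⟨C, hC.isLieSeries, rfl⟩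
  · rintro ⟨C, hC, rfl⟩
    have hE := hC.isPrimitive.isGroupLike_exp
    exact ⟨IsGroupLike.of_mul_right ((isGroupLike_map_iff hinj).2 hE) hS,
      hSol.of_mul_map (coeff_exp_nil C)⟩

end Solutions

end NCSeries

/-! ### Largest shuffles and factorization into Lyndon words -/

section LyndonWords

variable {X : Type*}

theorem word_cons_le_cons_iff [LinearOrder X] {x y : X} {a b : List X} :
    x :: a ≤ y :: b ↔ x < y ∨ x = y ∧ a ≤ b := by
  rw [← not_lt, List.cons_lt_cons_iff, ← not_lt (a := b)]
  constructor
  · intro h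
    rcases lt_trichotomy x y with hxy | hxy | hxy
    · exact Or.inl hxy
    · exact Or.inr ⟨hxy, fun h' => h (Or.inr ⟨hxy.symm, h'⟩)⟩
    · exact absurd (Or.inl hxy) h
  · rintro (h | ⟨rfl, h⟩) (h' | ⟨h', h''⟩)
    · exact lt_asymm h h'
    · exact h.ne h'.symm
    · exact lt_irrefl _ h'
    · exact h h''

theorem word_nil_le [LinearOrder X] (a : List X) : [] ≤ a := by
  rw [← not_lt]
  exact List.not_lt_nil a

theorem word_le_append [LinearOrder X] (a b : List X) : a ≤ a ++ b := by
  induction a with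
  | nil => exact word_nil_le _
  | cons x a ih => exact word_cons_le_cons_iff.2 (Or.inr ⟨rfl, ih⟩)

/-- `IsShuffleOf M w`: the word `w` is a shuffle of the words in the multiset `M`. -/
def IsShuffleOf : Multiset (List X) → List X → Prop
  | M, [] => ∀ s ∈ M, s = []
  | N, x :: v => ∃ s M, N = (x :: s) ::ₘ M ∧ IsShuffleOf (s ::ₘ M) v

namespace IsShuffleOf

theorem cons {x : X} {s : List X} {M : Multiset (List X)} {v : List X}
    (h : IsShuffleOf (s ::ₘ M) v) : IsShuffleOf ((x :: s) ::ₘ M) (x :: v) :=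
  ⟨s, M, rfl, h⟩

theorem nil_cons : ∀ {v : List X} {M : Multiset (List X)}, IsShuffleOf M v →
    IsShuffleOf ([] ::ₘ M) v
  | [], _, h => fun s hs => (Multiset.mem_cons.1 hs).elim id (h s)
  | x :: v, _, ⟨s, M, hM, h⟩ => by
    refine ⟨s, [] ::ₘ M, by rw [hM, Multiset.cons_swap], ?_⟩
    rw [Multiset.cons_swap]
    exact nil_cons h

theorem of_nil_cons : ∀ {v : List X} {M : Multiset (List X)}, IsShuffleOf ([] ::ₘ M) v →
    IsShuffleOf M v
  | [], _, h => fun s hs => h s (Multiset.mem_cons_of_mem hs)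
  | x :: v, _, ⟨s, M, hM, h⟩ => by
    rcases Multiset.cons_eq_cons.1 hM with ⟨h', _⟩ | ⟨_, cs, rfl, rfl⟩
    · exact absurd h' (by simp)
    · rw [Multiset.cons_swap] at h
      exact ⟨s, cs, rfl, of_nil_cons h⟩

theorem append {M : Multiset (List X)} {v : List X} (h : IsShuffleOf M v) (s : List X) :
    IsShuffleOf (s ::ₘ M) (s ++ v) := by
  induction s with
  | nil => exact nil_cons h
  | cons x s ih => exact ih.cons

theorem exists_word (M : Multiset (List X)) : ∃ v, IsShuffleOf M v := by
  induction M using Multiset.induction_on with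
  | empty => exact ⟨[], by simp [IsShuffleOf]⟩
  | cons s M ih =>
    obtain ⟨v, hv⟩ := ih
    exact ⟨_, hv.append s⟩

theorem of_mem_shuffle : ∀ {u w v : List X} {M : Multiset (List X)}, IsShuffleOf M w →
    v ∈ NCSeries.shuffle u w → IsShuffleOf (u ::ₘ M) v
  | [], w, v, M, hM, hv => by
    rw [NCSeries.shuffle_nil_left, List.mem_singleton] at hv
    rw [hv]
    exact nil_cons hM
  | x :: u, [], v, M, hM, hv => by
    rw [NCSeries.shuffle_nil_right, List.mem_singleton] at hv
    rw [hv]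
    simpa using hM.append (x :: u)
  | x :: u, y :: w, v, M, hM, hv => by
    rw [NCSeries.shuffle_cons_cons, List.mem_append, List.mem_map, List.mem_map] at hv
    rcases hv with ⟨v', hv', rfl⟩ | ⟨v', hv', rfl⟩
    · exact (of_mem_shuffle hM hv').cons
    · obtain ⟨s, N, rfl, hN⟩ := hM
      have := of_mem_shuffle hN hv'
      rw [Multiset.cons_swap] at this ⊢
      exact this.cons
termination_by u w => u.length + w.length

variable [LinearOrder X]

/-- Moving a prefix from a larger word to a smaller one does not decrease the largest shuffle. -/
theorem exchange : ∀ (v p s t : List X) (M : Multiset (List X)), t ≤ s →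
    IsShuffleOf ((p ++ s) ::ₘ t ::ₘ M) v →
    ∃ v', v ≤ v' ∧ IsShuffleOf (s ::ₘ (p ++ t) ::ₘ M) v'
  | [], p, s, t, M, _, _ => by
    obtain ⟨v', hv'⟩ := exists_word (s ::ₘ (p ++ t) ::ₘ M)
    exact ⟨v', word_nil_le v', hv'⟩
  | x :: v, p, s, t, M, hts, hv => by
    obtain ⟨r, N, hN, h⟩ := id hv
    rcases Multiset.cons_eq_cons.1 hN with ⟨hp, rfl⟩ | ⟨_, cs, hcs, rfl⟩
    · cases p with
      | nil => exact ⟨x :: v, le_rfl, hv⟩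
      | cons y p =>
        obtain ⟨rfl, rfl⟩ := List.cons.inj hp
        obtain ⟨v', hvv', hv'⟩ := exchange v p s t M hts h
        refine ⟨y :: v', word_cons_le_cons_iff.2 (Or.inr ⟨rfl, hvv'⟩), ?_⟩
        rw [Multiset.cons_swap] at hv' ⊢
        exact hv'.cons
    · rcases Multiset.cons_eq_cons.1 hcs with ⟨rfl, rfl⟩ | ⟨_, ds, rfl, rfl⟩
      · cases s with
        | nil => exact absurd (hts.antisymm (word_nil_le _)) (by simp)
        | cons e s =>
          -- The first letter of `v` comes from `t`. If `s` starts with a larger letter, any shuffle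
          -- starting with that letter wins.
          rcases word_cons_le_cons_iff.1 hts with hlt | ⟨rfl, hrs⟩
          · obtain ⟨w, hw⟩ := exists_word (s ::ₘ (p ++ x :: r) ::ₘ M)
            exact ⟨e :: w, word_cons_le_cons_iff.2 (Or.inl hlt), hw.cons⟩
          · rw [Multiset.cons_swap, ← List.singleton_append (l := s), ← List.append_assoc] at h
            obtain ⟨v', hvv', hv'⟩ := exchange v (p ++ [x]) s r M hrs h
            refine ⟨x :: v', word_cons_le_cons_iff.2 (Or.inr ⟨rfl, hvv'⟩), ?_⟩
            rw [List.append_assoc, List.singleton_append] at hv'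
            exact hv'.cons
      · have h' : IsShuffleOf ((p ++ s) ::ₘ t ::ₘ r ::ₘ ds) v := by
          rw [Multiset.cons_swap t, Multiset.cons_swap (p ++ s)]
          exact h
        obtain ⟨v', hvv', hv'⟩ := exchange v p s t (r ::ₘ ds) hts h'
        refine ⟨x :: v', word_cons_le_cons_iff.2 (Or.inr ⟨rfl, hvv'⟩), ?_⟩
        rw [Multiset.cons_swap (p ++ t), Multiset.cons_swap s] at hv' ⊢
        exact hv'.cons

/-- The largest shuffle can be chosen to start with the first letter of a largest word. -/
theorem exists_le_cons {e : X} {s v : List X} {M : Multiset (List X)}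
    (hM : ∀ t ∈ M, t ≤ e :: s) (hv : IsShuffleOf ((e :: s) ::ₘ M) v) :
    ∃ v', v ≤ e :: v' ∧ IsShuffleOf (s ::ₘ M) v' := by
  obtain ⟨w, hw⟩ := exists_word (s ::ₘ M)
  cases v with
  | nil => exact ⟨w, word_nil_le _, hw⟩
  | cons x v =>
    obtain ⟨r, N, hN, h⟩ := hv
    rcases Multiset.cons_eq_cons.1 hN with ⟨hs, rfl⟩ | ⟨_, cs, rfl, rfl⟩
    · obtain ⟨rfl, rfl⟩ := List.cons.inj hs
      exact ⟨v, le_rfl, h⟩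
    · rcases word_cons_le_cons_iff.1 (hM _ (Multiset.mem_cons_self _ _)) with hlt | ⟨rfl, hrs⟩
      · exact ⟨w, word_cons_le_cons_iff.2 (Or.inl hlt), hw⟩
      · rw [Multiset.cons_swap] at h
        obtain ⟨v', hvv', hv'⟩ := exchange v [x] s r cs hrs h
        exact ⟨v', word_cons_le_cons_iff.2 (Or.inr ⟨rfl, hvv'⟩), hv'⟩

end IsShuffleOf

variable [LinearOrder X]

theorem IsLyndon.le_of_append {l u v : List X} (hl : IsLyndon l) (hv : v ≠ []) (h : l = u ++ v) :
    l ≤ v := by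
  by_cases hu : u = []
  · rw [h, hu, List.nil_append]
  · exact (hl.2 u v hu hv h).le

theorem isLyndon_singleton (x : X) : IsLyndon [x] := by
  refine ⟨by simp, fun u v hu hv h => ?_⟩
  have h1 := congrArg List.length h
  have h2 := List.length_pos_iff.2 hu
  have h3 := List.length_pos_iff.2 hv
  rw [List.length_append, List.length_singleton] at h1
  omega

/-- The largest shuffle of a nonincreasing list of Lyndon words is their concatenation. -/
theorem IsShuffleOf.le_flatten : ∀ {L : List (List X)}, (∀ l ∈ L, IsLyndon l) →
    L.Pairwise (· ≥ ·) → ∀ {v : List X}, IsShuffleOf (L : Multiset (List X)) v → v ≤ L.flatten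
  | [], _, _, [], _ => le_rfl
  | [], _, _, x :: v, h => by
    obtain ⟨s, M, hM, _⟩ := h
    exact absurd hM.symm (by simp)
  | l :: L, hL, hp, v, hv => by
    rw [List.pairwise_cons] at hp
    -- Generalization to the suffixes of the first word `l`: a nonempty suffix is at least `l`,
    -- hence at least every other word, so the greedy choice keeps reading it until it is exhausted.
    have key : ∀ (s : List X) {v : List X}, (∃ u, l = u ++ s) →
        IsShuffleOf (s ::ₘ (L : Multiset (List X))) v → v ≤ s ++ L.flatten := by
      intro s
      induction s with
      | nil =>
        intro v _ h
        exact IsShuffleOf.le_flatten (fun l hl => hL l (List.mem_cons_of_mem _ hl)) hp.2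
          h.of_nil_cons
      | cons e s ih =>
        rintro v ⟨u, hu⟩ h
        obtain ⟨v', hvv', hv'⟩ := IsShuffleOf.exists_le_cons (fun t ht =>
          (hp.1 t ht).le.trans ((hL l List.mem_cons_self).le_of_append (by simp) hu)) h
        refine hvv'.trans (word_cons_le_cons_iff.2 (Or.inr ⟨rfl, ih ⟨u ++ [e], ?_⟩ hv'⟩))
        rw [hu, List.append_assoc, List.singleton_append]
    exact key l ⟨[], rfl⟩ hv

/-- A lower bound of a list of Lyndon words bounds all nonempty suffixes of their
concatenation. -/
theorem le_suffix_flatten {l : List X} : ∀ {L : List (List X)}, (∀ a ∈ L, IsLyndon a) →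
    (∀ a ∈ L, l ≤ a) → ∀ {u s : List X}, s ≠ [] → L.flatten = u ++ s → l ≤ s
  | [], _, _, u, s, hs, h => by
    rw [List.flatten_nil, eq_comm, List.append_eq_nil_iff] at h
    exact absurd h.2 hs
  | a :: L, hL, hl, u, s, hs, h => by
    rw [List.flatten_cons] at h
    rcases List.append_eq_append_iff.1 h with ⟨c, _, hc⟩ | ⟨c, hc, rfl⟩
    · exact le_suffix_flatten (fun a ha => hL a (List.mem_cons_of_mem _ ha))
        (fun a ha => hl a (List.mem_cons_of_mem _ ha)) hs hc
    · by_cases h0 : c = []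
      · subst h0
        exact le_suffix_flatten (u := []) (fun a ha => hL a (List.mem_cons_of_mem _ ha))
          (fun a ha => hl a (List.mem_cons_of_mem _ ha)) hs (by simp)
      · exact (hl a List.mem_cons_self).trans
          (((hL a List.mem_cons_self).le_of_append h0 hc).trans (word_le_append _ _))

theorem flatten_ne_nil {L : List (List X)} (hL : ∀ l ∈ L, IsLyndon l) (h : L ≠ []) :
    L.flatten ≠ [] := by
  cases L with
  | nil => exact absurd rfl h
  | cons a L =>
    rw [List.flatten_cons]
    exact fun h' => (hL a List.mem_cons_self).1 (List.append_eq_nil_iff.1 h').1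

/-- Uniqueness of the nonincreasing factorization into Lyndon words. -/
theorem lyndon_factorization_unique {L L' : List (List X)} (hL : ∀ l ∈ L, IsLyndon l)
    (hp : L.Pairwise (· ≥ ·)) (hL' : ∀ l ∈ L', IsLyndon l) (hp' : L'.Pairwise (· ≥ ·))
    (h : L.flatten = L'.flatten) : L = L' := by
  induction L using List.reverseRecOn generalizing L' with
  | nil =>
    by_contra hne
    exact flatten_ne_nil hL' (Ne.symm hne) h.symm
  | append_singleton L l ih =>
    rcases List.eq_nil_or_concat L' with rfl | ⟨L'', l', rfl⟩
    · exact absurd h (flatten_ne_nil hL (by simp))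
    · rw [List.concat_eq_append] at *
      have hlow : ∀ {N : List (List X)} {b : List X}, (N ++ [b]).Pairwise (· ≥ ·) →
          ∀ a ∈ N ++ [b], b ≤ a := by
        intro N b hN a ha
        rw [List.mem_append, List.mem_singleton] at ha
        rcases ha with ha | rfl
        · exact (List.pairwise_append.1 hN).2.2 a ha b (by simp)
        · exact le_rfl
      have h1 : ∀ (N : List (List X)) (b : List X), (N ++ [b]).flatten = N.flatten ++ b := by
        intro N b
        simp
      -- Each last factor is the smallest of its list, so it bounds from below every nonempty suffix
      -- of the common concatenation, in particular the other last factor.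
      have hl : l = l' := by
        apply le_antisymm
        · exact le_suffix_flatten hL (hlow hp) (hL' l' (by simp)).1 (h.trans (h1 L'' l'))
        · exact le_suffix_flatten hL' (hlow hp') (hL l (by simp)).1 (h.symm.trans (h1 L l))
      subst hl
      rw [h1, h1, List.append_cancel_right_eq] at h
      rw [ih (fun a ha => hL a (by simp [ha])) (List.pairwise_append.1 hp).1
        (fun a ha => hL' a (by simp [ha])) (List.pairwise_append.1 hp').1 h]

end LyndonWords

namespace NCSeries

/-! ### Iterated shuffle products -/

section ShuffleProducts

variable {X : Type*}

theorem append_mem_shuffle (u v : List X) : u ++ v ∈ shuffle u v := by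
  induction u with
  | nil => simp [shuffle_nil_left]
  | cons x u ih =>
    cases v with
    | nil => simp [shuffle_nil_right]
    | cons y v =>
      rw [shuffle_cons_cons, List.mem_append]
      exact Or.inl (List.mem_map_of_mem ih)

/-- The words occurring in the shuffle product of a list of words, with multiplicity. -/
def shuffleList : List (List X) → List (List X)
  | [] => [[]]
  | u :: L => (shuffleList L).flatMap (shuffle u)

theorem flatten_mem_shuffleList (L : List (List X)) : L.flatten ∈ shuffleList L := by
  induction L with
  | nil => simp [shuffleList]
  | cons u L ih =>
    rw [shuffleList, List.mem_flatMap]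
    exact ⟨_, ih, append_mem_shuffle u _⟩

theorem isShuffleOf_of_mem_shuffleList {L : List (List X)} {v : List X}
    (h : v ∈ shuffleList L) : IsShuffleOf (L : Multiset (List X)) v := by
  induction L generalizing v with
  | nil =>
    rw [shuffleList, List.mem_singleton] at h
    rw [h]
    simp [IsShuffleOf]
  | cons u L ih =>
    rw [shuffleList, List.mem_flatMap] at h
    obtain ⟨w, hw, hv⟩ := h
    exact IsShuffleOf.of_mem_shuffle (ih hw) hv

theorem IsGroupLike.sum_shuffleList {R : Type*} [CommRing R] {S : NCSeries R X}
    (hS : S.IsGroupLike) (L : List (List X)) :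
    ((shuffleList L).map S.coeff).sum = (L.map S.coeff).prod := by
  induction L with
  | nil => simp [shuffleList, hS.1]
  | cons u L ih =>
    rw [List.map_cons, List.prod_cons, ← ih, shuffleList, ← List.sum_map_mul_left]
    generalize shuffleList L = N
    induction N with
    | nil => simp
    | cons w N ihN =>
      rw [List.flatMap_cons, List.map_append, List.sum_append, ihN, List.map_cons, List.sum_cons,
        ← hS.2 u w]

end ShuffleProducts

/-! ### Algebraic independence at Lyndon words -/

section Lyndon

variable {X : Type*} [LinearOrder X]

/-- The nonincreasing list of Lyndon words with given multiplicities. -/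
noncomputable def lyndonList (m : {l : List X // IsLyndon l} →₀ ℕ) : List (List X) :=
  ((Finsupp.toMultiset m).map Subtype.val).sort (· ≥ ·)

theorem coe_lyndonList (m : {l : List X // IsLyndon l} →₀ ℕ) :
    (lyndonList m : Multiset (List X)) = (Finsupp.toMultiset m).map Subtype.val :=
  Multiset.sort_eq _ _

theorem isLyndon_of_mem_lyndonList {m : {l : List X // IsLyndon l} →₀ ℕ} {l : List X}
    (h : l ∈ lyndonList m) : IsLyndon l := by
  rw [← Multiset.mem_coe, coe_lyndonList, Multiset.mem_map] at h
  obtain ⟨a, _, rfl⟩ := h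
  exact a.2

theorem pairwise_lyndonList (m : {l : List X // IsLyndon l} →₀ ℕ) :
    (lyndonList m).Pairwise (· ≥ ·) :=
  Multiset.pairwise_sort _ _

theorem flatten_lyndonList_injective :
    Function.Injective fun m : {l : List X // IsLyndon l} →₀ ℕ => (lyndonList m).flatten := by
  intro m m' h
  have h1 := lyndon_factorization_unique (fun _ hl => isLyndon_of_mem_lyndonList hl)
    (pairwise_lyndonList m) (fun _ hl => isLyndon_of_mem_lyndonList hl)
    (pairwise_lyndonList m') h
  have h2 := congrArg (fun L : List (List X) => (L : Multiset (List X))) h1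
  simp only [coe_lyndonList] at h2
  classical
  exact Multiset.toFinsupp.symm.injective (Multiset.map_injective Subtype.val_injective h2)

theorem prod_map_lyndonList {A : Type*} [CommRing A] (f : List X → A)
    (m : {l : List X // IsLyndon l} →₀ ℕ) :
    ((lyndonList m).map f).prod = ∏ l ∈ m.support, f l ^ m l := by
  rw [← Multiset.prod_coe, ← Multiset.map_coe, coe_lyndonList, Multiset.map_map,
    Finsupp.toMultiset_map, Finsupp.prod_toMultiset,
    Finsupp.prod_mapDomain_index (fun _ => pow_zero _) (fun _ _ _ => pow_add _ _ _)]
  rfl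

/-- If the coefficients of a group-like series are linearly independent, then its coefficients at
Lyndon words are algebraically independent. -/
theorem IsGroupLike.algebraicIndependent_lyndon {R A : Type*} [CommRing R] [IsDomain R]
    [CharZero R] [CommRing A] [Algebra R A] {S : NCSeries A X} (hS : S.IsGroupLike)
    (h : LinearIndependent R fun w : List X => S.coeff w) :
    AlgebraicIndependent R fun l : {l : List X // IsLyndon l} => S.coeff l := by
  classical
  rw [algebraicIndependent_iff]
  intro p hp
  by_contra hp0
  -- Leading monomial: the one whose nonincreasing concatenation of Lyndon words is the largest.
  obtain ⟨m₀, hm₀, hmax⟩ := p.support.exists_max_image (fun m => (lyndonList m).flatten)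
    (MvPolynomial.support_nonempty.2 hp0)
  let Q : ({l : List X // IsLyndon l} →₀ ℕ) → List X →₀ R := fun m =>
    ((shuffleList (lyndonList m)).map fun w => Finsupp.single w (1 : R)).sum
  have hQ : ∀ m, Finsupp.linearCombination R (fun w : List X => S.coeff w) (Q m) =
      ∏ l ∈ m.support, S.coeff l ^ m l := by
    intro m
    rw [map_list_sum, List.map_map, ← prod_map_lyndonList, ← hS.sum_shuffleList]
    congr 1
    refine List.map_congr_left fun w _ => ?_
    simp
  have hcount : ∀ m w, Q m w = ((shuffleList (lyndonList m)).count w : R) := by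
    intro m w
    change ((shuffleList (lyndonList m)).map fun w => Finsupp.single w (1 : R)).sum w = _
    generalize shuffleList (lyndonList m) = N
    induction N with
    | nil => simp
    | cons a N ih =>
      rw [List.map_cons, List.sum_cons, Finsupp.add_apply, ih, List.count_cons,
        Finsupp.single_apply]
      by_cases haw : a = w <;> simp [haw, add_comm]
  have hzero : ∑ m ∈ p.support, p.coeff m • Q m = 0 := by
    apply linearIndependent_iff.1 h
    rw [map_sum, ← hp, MvPolynomial.aeval_def, MvPolynomial.eval₂_eq]
    refine Finset.sum_congr rfl fun m _ => ?_
    rw [map_smul, hQ, Algebra.smul_def]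
  -- At the leading word only `m₀` contributes, with a positive integral multiplicity, which is
  -- nonzero in characteristic zero.
  have hcoef := DFunLike.congr_fun hzero (lyndonList m₀).flatten
  rw [Finsupp.finsetSum_apply, Finset.sum_eq_single_of_mem m₀ hm₀, Finsupp.smul_apply,
    smul_eq_mul, Finsupp.zero_apply, mul_eq_zero, hcount, Nat.cast_eq_zero,
    List.count_eq_zero] at hcoef
  · exact hcoef.elim (MvPolynomial.mem_support_iff.1 hm₀)
      fun h' => h' (flatten_mem_shuffleList _)
  · intro m hm hne
    rw [Finsupp.smul_apply, hcount, List.count_eq_zero.2, Nat.cast_zero, smul_zero]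
    intro hmem
    have hle := IsShuffleOf.le_flatten (fun _ hl => isLyndon_of_mem_lyndonList hl)
      (pairwise_lyndonList m) (isShuffleOf_of_mem_shuffleList hmem)
    exact hne (flatten_lyndonList_injective ((hmax m hm).antisymm hle))

end Lyndon

end NCSeries

/-! ### The differential subfield of fractions -/

section FractionFields

variable {F A : Type*} [Field F] [CommRing A] [IsDomain A] [Algebra F A]

theorem mem_fracSubfield_iff {C₀ : Subalgebra F A} {f : FractionRing A} :
    f ∈ fracSubfield C₀ ↔ ∃ a ∈ C₀, ∃ b ∈ C₀, b ≠ 0 ∧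
      f = algebraMap A (FractionRing A) a / algebraMap A (FractionRing A) b := by
  have hadj : Algebra.adjoin F (algebraMap A (FractionRing A) '' (C₀ : Set A)) =
      C₀.map (IsScalarTower.toAlgHom F A (FractionRing A)) :=
    Algebra.adjoin_eq (C₀.map (IsScalarTower.toAlgHom F A (FractionRing A)))
  rw [fracSubfield, IntermediateField.mem_adjoin_iff_div, hadj]
  constructor
  · rintro ⟨_, ⟨a, ha, rfl⟩, _, ⟨b, hb, rfl⟩, rfl⟩
    by_cases hb0 : b = 0
    · exact ⟨0, C₀.zero_mem, 1, C₀.one_mem, one_ne_zero, by simp [hb0]⟩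
    · exact ⟨a, ha, b, hb, hb0, rfl⟩
  · rintro ⟨a, ha, b, hb, _, rfl⟩
    exact ⟨_, ⟨a, ha, rfl⟩, _, ⟨b, hb, rfl⟩, rfl⟩

theorem algebraMap_mem_fracSubfield {C₀ : Subalgebra F A} {a : A} (ha : a ∈ C₀) :
    algebraMap A (FractionRing A) a ∈ fracSubfield C₀ :=
  mem_fracSubfield_iff.2 ⟨a, ha, 1, C₀.one_mem, one_ne_zero, by simp⟩

theorem fracDeriv_mem_fracSubfield {D : Derivation F A A} {C₀ : Subalgebra F A}
    (hC₀ : ∀ a ∈ C₀, D a ∈ C₀) {f : FractionRing A} (hf : f ∈ fracSubfield C₀) :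
    fracDeriv D f ∈ fracSubfield C₀ := by
  obtain ⟨a, ha, b, hb, hb0, rfl⟩ := mem_fracSubfield_iff.1 hf
  rw [fracDeriv_div D a b hb0, ← map_pow]
  exact mem_fracSubfield_iff.2 ⟨_, C₀.sub_mem (C₀.mul_mem (hC₀ a ha) hb)
    (C₀.mul_mem ha (hC₀ b hb)), _, C₀.pow_mem hb 2, pow_ne_zero 2 hb0, rfl⟩

end FractionFields

namespace NCSeries

/-! ### Linear relations between the coefficients and their derivatives -/

section TransposedMultiplication

variable {F X : Type*} [Field F]

/-- The transpose of the left multiplication of series by `∑ x, u x • x`, on polynomials. -/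
noncomputable def transposeMul (u : X → F) : (List X →₀ F) →ₗ[F] (List X →₀ F) :=
  Finsupp.linearCombination F fun w => match w with
    | [] => 0
    | x :: v => Finsupp.single v (u x)

/-- The coefficients of a polynomial at the words `x :: w`. -/
noncomputable def consCoeff (w : List X) (P : List X →₀ F) : X →₀ F :=
  P.comapDomain (fun x => x :: w) fun _ _ _ _ h => (List.cons.inj h).1

@[simp] theorem consCoeff_apply (w : List X) (P : List X →₀ F) (x : X) :
    consCoeff w P x = P (x :: w) := rfl

theorem transposeMul_apply (u : X → F) (P : List X →₀ F) (w : List X) :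
    transposeMul u P w = Finsupp.linearCombination F u (consCoeff w P) := by
  classical
  induction P using Finsupp.induction_linear with
  | zero =>
    have : consCoeff w (0 : List X →₀ F) = 0 := by ext; simp
    rw [this, map_zero, map_zero, Finsupp.zero_apply]
  | add P Q hP hQ =>
    have : consCoeff w (P + Q) = consCoeff w P + consCoeff w Q := by ext; simp
    rw [this, map_add, map_add, Finsupp.add_apply, hP, hQ]
  | single v a =>
    rw [transposeMul, Finsupp.linearCombination_single]
    cases v with
    | nil =>
      have : consCoeff w (Finsupp.single [] a) = 0 := by ext; simp
      rw [this, map_zero, smul_zero, Finsupp.zero_apply]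
    | cons y v =>
      by_cases h : v = w
      · subst h
        have : consCoeff v (Finsupp.single (y :: v) a) = Finsupp.single y a := by
          ext x
          by_cases hx : y = x <;> simp [hx]
        rw [this, Finsupp.linearCombination_single]
        simp
      · have : consCoeff w (Finsupp.single (y :: v) a) = 0 := by
          ext x
          simp [h]
        rw [this, map_zero]
        simp [h]

end TransposedMultiplication

section SolutionCoefficients

variable {k A X : Type*} [CommRing k] [CommRing A] [Algebra k A] {D : Derivation k A A}
  {u : X → A} {S : NCSeries A X}

theorem IsSolution.deriv_coeff_nil (hS : S.IsSolution D u) : D (S.coeff []) = 0 := by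
  rw [hS.2, Derivation.map_one_eq_zero]

theorem IsSolution.deriv_coeff_cons (hS : S.IsSolution D u) (x : X) (w : List X) :
    D (S.coeff (x :: w)) = u x * S.coeff w := by
  have h : residual x (ofLetters u) = u x • (1 : NCSeries A X) := by
    ext v
    cases v <;> simp [ofLetters, coeff_one]
  rw [← coeff_deriv, hS.1, ← coeff_residual, residual_mul, h, smul_mul_assoc, one_mul]
  simp [ofLetters]

end SolutionCoefficients

section Evaluation

variable {F A X : Type*} [Field F] [CommRing A] [Algebra F A] {C₀ : Subalgebra F A}
  {S : NCSeries A X}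

local notation "φ" => algebraMap A (FractionRing A)

/-- Evaluation of a polynomial over the field of fractions at the coefficients of a series. -/
noncomputable def evalAt (S : NCSeries A X) :
    (List X →₀ FractionRing A) →ₗ[FractionRing A] FractionRing A :=
  Finsupp.linearCombination (FractionRing A) fun w => φ (S.coeff w)

theorem evalAt_mapRange (g : List X →₀ C₀) :
    evalAt S (g.mapRange (fun a : C₀ => φ a) (map_zero _)) =
      φ (Finsupp.linearCombination C₀ (fun w : List X => S.coeff w) g) := by
  rw [evalAt, Finsupp.linearCombination_apply, Finsupp.linearCombination_apply,
    Finsupp.sum_mapRange_index (by simp), Finsupp.sum, Finsupp.sum, map_sum]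
  exact Finset.sum_congr rfl fun w _ => by rw [smul_eq_mul, ← map_mul]; rfl

end Evaluation

/-! ### Independence criteria: assertion 2 -/

section Independence

variable {F A X : Type*} [Field F] [CommRing A] [IsDomain A] [Algebra F A]
  {D : Derivation F A A} {C₀ : Subalgebra F A} {u : X → A} {S : NCSeries A X}

local notation "φ" => algebraMap A (FractionRing A)

/-- The polynomial `∂P + M†P`, whose evaluation is the derivative of that of `P`. -/
noncomputable def derivRelation (D : Derivation F A A) (u : X → A)
    (P : List X →₀ FractionRing A) : List X →₀ FractionRing A :=
  P.mapRange (fracDeriv D) (map_zero _) + transposeMul (fun x => φ (u x)) P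

theorem derivRelation_apply (P : List X →₀ FractionRing A) (w : List X) :
    derivRelation D u P w = fracDeriv D (P w) +
      Finsupp.linearCombination (FractionRing A) (fun x => φ (u x)) (consCoeff w P) := by
  rw [derivRelation, Finsupp.add_apply, Finsupp.mapRange_apply, transposeMul_apply]

theorem IsSolution.evalAt_derivRelation (hS : S.IsSolution D u)
    (P : List X →₀ FractionRing A) :
    evalAt S (derivRelation D u P) = fracDeriv D (evalAt S P) := by
  rw [derivRelation, map_add]
  induction P using Finsupp.induction_linear with
  | zero => simp
  | add P Q hP hQ =>
    rw [Finsupp.mapRange_add (map_add _), map_add, map_add, map_add, map_add, map_add, ← hP, ← hQ]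
    abel
  | single v a =>
    rw [Finsupp.mapRange_single, evalAt, transposeMul, Finsupp.linearCombination_single,
      Finsupp.linearCombination_single, Finsupp.linearCombination_single, smul_eq_mul,
      smul_eq_mul, Derivation.leibniz, fracDeriv_algebraMap]
    cases v with
    | nil =>
      rw [hS.deriv_coeff_nil]
      simp [mul_comm]
    | cons x v =>
      rw [hS.deriv_coeff_cons, map_smul, Finsupp.linearCombination_single, map_mul]
      simp only [smul_eq_mul]
      ring

open Classical in
/-- A solution has no nontrivial linear relation over the field of fractions of `C₀`, if no
nontrivial constant combination of the multipliers has a primitive there. -/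
theorem IsSolution.relation_eq_zero (hS : S.IsSolution D u) (hC₀ : ∀ a ∈ C₀, D a ∈ C₀)
    (hu : ∀ x, u x ∈ C₀)
    (hconst : ∀ f ∈ fracSubfield C₀, fracDeriv D f = 0 →
      ∃ c : F, algebraMap F (FractionRing A) c = f)
    (hprim : ∀ f ∈ fracSubfield C₀, ∀ c : X →₀ F,
      (c.sum fun x r => r • φ (u x)) = fracDeriv D f → ∀ x, c x = 0) (n : ℕ) :
    ∀ P : List X →₀ FractionRing A, (∀ w, P w ∈ fracSubfield C₀) → evalAt S P = 0 →
      (∀ w, n ≤ w.length → P w = 0) → P = 0 := by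
  induction n with
  | zero => exact fun P _ _ h => Finsupp.ext fun w => h w (Nat.zero_le _)
  | succ n ihn =>
    -- Inner induction on the number `k` of words of the top length `n` in the relation.
    suffices H : ∀ (k : ℕ) (P : List X →₀ FractionRing A), (∀ w, P w ∈ fracSubfield C₀) →
        evalAt S P = 0 → (∀ w, n + 1 ≤ w.length → P w = 0) →
        (P.support.filter fun w => w.length = n).card = k → P = 0 from
      fun P h1 h2 h3 => H _ P h1 h2 h3 rfl
    intro k
    induction k using Nat.strong_induction_on with
    | _ k ihk =>
      intro P hPK hP0 hPn hPk
      by_cases hex : ∀ w, w.length = n → P w = 0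
      · refine ihn P hPK hP0 fun w hw => ?_
        rcases hw.eq_or_lt with h | h
        · exact hex w h.symm
        · exact hPn w h
      exfalso
      push Not at hex
      obtain ⟨w₀, hw₀, hPw₀⟩ := hex
      set P' : List X →₀ FractionRing A := (P w₀)⁻¹ • P with hP'
      have hP'w : ∀ w, P' w = (P w₀)⁻¹ * P w := fun w => by
        rw [hP', Finsupp.smul_apply, smul_eq_mul]
      have hP'zero : ∀ w, P w = 0 → P' w = 0 := fun w h => by rw [hP'w, h, mul_zero]
      have hP'K : ∀ w, P' w ∈ fracSubfield C₀ := fun w => by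
        rw [hP'w]
        exact mul_mem (inv_mem (hPK w₀)) (hPK w)
      have hP'1 : P' w₀ = 1 := by rw [hP'w, inv_mul_cancel₀ hPw₀]
      have hP'0 : evalAt S P' = 0 := by rw [hP', map_smul, hP0, smul_zero]
      have hcons : ∀ w : List X, n ≤ w.length → consCoeff w P' = 0 := fun w hw =>
        Finsupp.ext fun x => hP'zero _ (hPn _ (by simpa using hw))
      have htop : ∀ w : List X, n ≤ w.length →
          derivRelation D u P' w = fracDeriv D (P' w) := fun w hw => by
        rw [derivRelation_apply, hcons w hw, map_zero, add_zero]
      -- The derived relation loses the top word `w₀`, whose coefficient is 1, and gains no other: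
      -- `transposeMul` shortens words.
      have hQ : derivRelation D u P' = 0 := by
        refine ihk _ ?_ (derivRelation D u P') ?_ ?_ ?_ rfl
        · rw [← hPk]
          apply Finset.card_lt_card
          rw [Finset.ssubset_iff_of_subset]
          · refine ⟨w₀, by simp [hw₀, hPw₀], ?_⟩
            simp [htop w₀ hw₀.ge, hP'1]
          · intro w hw
            simp only [Finset.mem_filter, Finsupp.mem_support_iff] at hw ⊢
            refine ⟨fun h => hw.1 ?_, hw.2⟩
            rw [htop w hw.2.ge, hP'zero w h, map_zero]
        · intro w
          rw [derivRelation_apply]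
          refine add_mem (fracDeriv_mem_fracSubfield hC₀ (hP'K w)) ?_
          rw [Finsupp.linearCombination_apply, Finsupp.sum]
          exact sum_mem fun x _ => mul_mem (hP'K _) (algebraMap_mem_fracSubfield (hu x))
        · rw [hS.evalAt_derivRelation, hP'0, map_zero]
        · intro w hw
          rw [htop w (by omega), hP'zero w (hPn w hw), map_zero]
      have hc : ∀ w : List X, w.length = n →
          ∃ c : F, algebraMap F (FractionRing A) c = P' w := fun w hw =>
        hconst _ (hP'K w) (by rw [← htop w hw.ge, hQ, Finsupp.zero_apply])
      cases w₀ with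
      -- Top length zero: the relation reads `1 = 0`.
      | nil =>
        have hP'eq : P' = Finsupp.single [] 1 := by
          ext w
          by_cases hw : w = []
          · rw [hw, hP'1, Finsupp.single_eq_same]
          · rw [Finsupp.single_eq_of_ne hw]
            refine hP'zero w (hPn w ?_)
            have := List.length_pos_iff.2 hw
            rw [List.length_nil] at hw₀
            omega
        rw [hP'eq, evalAt, Finsupp.linearCombination_single, hS.2, map_one, smul_eq_mul,
          mul_one] at hP'0
        exact one_ne_zero hP'0
      | cons y w₁ =>
        -- The value of `g` off the constants is arbitrary; it is only evaluated on top
        -- coefficients, which are constants, and at zero.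
        let g : FractionRing A → F := Function.invFun (algebraMap F (FractionRing A))
        have hg : ∀ c, g (algebraMap F (FractionRing A) c) = c :=
          Function.leftInverse_invFun (algebraMap F (FractionRing A)).injective
        have hg0 : g 0 = 0 := by rw [← map_zero (algebraMap F (FractionRing A)), hg]
        have hgP : ∀ x : X, algebraMap F (FractionRing A) (g (P' (x :: w₁))) = P' (x :: w₁) := by
          intro x
          obtain ⟨c, hc⟩ := hc (x :: w₁) (by simpa using hw₀)
          rw [← hc, hg]
        -- This is the coefficient of the derived relation at `w₁`; the coefficient of `u y` in it
        -- is 1, which contradicts `hprim`.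
        have hsum : ((consCoeff w₁ P').mapRange g hg0).sum (fun x r => r • φ (u x)) =
            fracDeriv D (-P' w₁) := by
          have h1 : derivRelation D u P' w₁ = 0 := by rw [hQ, Finsupp.zero_apply]
          rw [derivRelation_apply] at h1
          rw [map_neg, eq_neg_iff_add_eq_zero, add_comm, ← h1, Finsupp.linearCombination_apply,
            Finsupp.sum_mapRange_index (by simp)]
          congr 1
          refine Finset.sum_congr rfl fun x _ => ?_
          dsimp only
          rw [consCoeff_apply, Algebra.smul_def, hgP, smul_eq_mul]
        have h0 := hprim _ (neg_mem (hP'K w₁)) _ hsum y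
        rw [Finsupp.mapRange_apply, consCoeff_apply] at h0
        have h1 := hgP y
        rw [h0, map_zero, hP'1] at h1
        exact zero_ne_one h1

theorem IsSolution.linearIndependent (hS : S.IsSolution D u) (hC₀ : ∀ a ∈ C₀, D a ∈ C₀)
    (hu : ∀ x, u x ∈ C₀)
    (hconst : ∀ f ∈ fracSubfield C₀, fracDeriv D f = 0 →
      ∃ c : F, algebraMap F (FractionRing A) c = f)
    (hprim : ∀ f ∈ fracSubfield C₀, ∀ c : X →₀ F,
      (c.sum fun x r => r • φ (u x)) = fracDeriv D f → ∀ x, c x = 0) :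
    LinearIndependent C₀ fun w : List X => S.coeff w := by
  rw [linearIndependent_iff]
  intro g hg
  set P : List X →₀ FractionRing A := g.mapRange (fun a : C₀ => φ a) (map_zero _) with hP
  have hP0 : P = 0 := by
    refine hS.relation_eq_zero hC₀ hu hconst hprim (P.support.sup List.length + 1) P ?_ ?_ ?_
    · exact fun w => algebraMap_mem_fracSubfield (g w).2
    · rw [hP, evalAt_mapRange, hg, map_zero]
    · intro w hw
      by_contra hne
      have := Finset.le_sup (f := List.length) (Finsupp.mem_support_iff.2 hne)
      omega
  ext w
  have h := DFunLike.congr_fun hP0 w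
  rw [hP, Finsupp.mapRange_apply, Finsupp.zero_apply] at h
  exact IsFractionRing.injective A (FractionRing A) (h.trans (map_zero _).symm)

/-- The polynomials `1` and the variables are distinct monomials, and evaluation at an algebraically
independent family is injective. -/
theorem linearIndependent_option_of_algebraicIndependent {R B ι : Type*} [CommRing R] [CommRing B]
    [Algebra R B] {f : ι → B} (hf : AlgebraicIndependent R f) :
    LinearIndependent R fun o : Option ι => o.elim 1 f := by
  have h1 := (MvPolynomial.basisMonomials ι R).linearIndependent.comp
    (fun o : Option ι => o.elim 0 fun i => Finsupp.single i 1) (by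
      rintro (_ | i) (_ | j) h
      · rfl
      · exact absurd h.symm (by simp)
      · exact absurd h (by simp)
      · exact congrArg some (Finsupp.single_left_injective one_ne_zero h))
  have h2 := h1.map' (MvPolynomial.aeval f).toLinearMap (LinearMap.ker_eq_bot.2 hf)
  have h3 : (fun o : Option ι => o.elim 1 f) = (MvPolynomial.aeval f).toLinearMap ∘
      MvPolynomial.basisMonomials ι R ∘
        fun o : Option ι => o.elim 0 fun i => Finsupp.single i 1 := by
    funext o
    cases o with
    | none => simp
    | some i => simp [MvPolynomial.aeval_monomial]
  rw [h3]
  exact h2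

/-- If `1` and the coefficients at the letters are linearly independent, then no nontrivial
constant combination of the multipliers has a primitive in the field of fractions of `C₀`. -/
theorem IsSolution.eq_zero_of_sum_eq_fracDeriv (hS : S.IsSolution D u)
    (hconst : ∀ a : A, ∀ b ∈ C₀, b ≠ 0 → fracDeriv D (φ a / φ b) = 0 →
      ∃ c : F, algebraMap F (FractionRing A) c = φ a / φ b)
    (hlin : LinearIndependent C₀ fun o : Option X => S.coeff (o.elim [] fun x => [x]))
    {f : FractionRing A} (hf : f ∈ fracSubfield C₀) (c : X →₀ F)
    (h : (c.sum fun x r => r • φ (u x)) = fracDeriv D f) (x : X) : c x = 0 := by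
  obtain ⟨a, ha, b, hb, hb0, rfl⟩ := mem_fracSubfield_iff.1 hf
  have hφ := IsFractionRing.injective A (FractionRing A)
  have hφb : φ b ≠ 0 := fun h => hb0 (hφ (h.trans (map_zero _).symm))
  set s : A := c.sum fun x r => r • S.coeff [x] with hs
  have hDs : D s = c.sum fun x r => r • u x := by
    rw [hs, Finsupp.sum, map_sum]
    refine Finset.sum_congr rfl fun x _ => ?_
    rw [Derivation.map_smul, hS.deriv_coeff_cons, hS.2, mul_one]
  have hφs : fracDeriv D (φ s) = fracDeriv D (φ a / φ b) := by
    rw [fracDeriv_algebraMap, hDs, ← h, Finsupp.sum, Finsupp.sum, map_sum]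
    exact Finset.sum_congr rfl fun x _ =>
      map_smul (IsScalarTower.toAlgHom F A (FractionRing A)) _ _
  have hdiv : φ (s * b - a) / φ b = φ s - φ a / φ b := by
    rw [map_sub, map_mul]
    field_simp
  -- Both `s` and `a / b` are primitives of the same element, so their difference, a fraction with
  -- denominator in `C₀`, is a constant `r`.
  obtain ⟨r, hr⟩ := hconst (s * b - a) b hb hb0 (by rw [hdiv, map_sub, hφs, sub_self])
  have hrel : s * b - a = algebraMap F A r * b := by
    apply hφ
    rw [map_mul, ← IsScalarTower.algebraMap_apply, hr, div_mul_cancel₀ _ hφb]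
  let a' : C₀ := ⟨a, ha⟩
  let b' : C₀ := ⟨b, hb⟩
  -- The relation `∑ c_x b ⟨S|x⟩ - (a + r b) = 0`, obtained by clearing the denominator `b`.
  let g : Option X →₀ C₀ := Finsupp.embDomain Function.Embedding.some
    (c.mapRange (fun r => algebraMap F C₀ r * b') (by simp)) -
      Finsupp.single none (a' + algebraMap F C₀ r * b')
  have hg : g = 0 := by
    apply linearIndependent_iff.1 hlin
    rw [map_sub, Finsupp.linearCombination_single, Finsupp.linearCombination_embDomain,
      Finsupp.linearCombination_apply, Finsupp.sum_mapRange_index (by simp)]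
    have h1 : (c.sum fun x r => (algebraMap F C₀ r * b') •
        ((fun o : Option X => S.coeff (o.elim [] fun x => [x])) ∘
          Function.Embedding.some) x) = s * b := by
      rw [hs, Finsupp.sum, Finsupp.sum, Finset.sum_mul]
      refine Finset.sum_congr rfl fun x _ => ?_
      rw [Algebra.smul_def (c x) (S.coeff [x])]
      change (algebraMap F A (c x) * b) * S.coeff [x] = _
      ring
    have h2 : (a' + algebraMap F C₀ r * b') •
        S.coeff ((none : Option X).elim [] fun x => [x]) = a + algebraMap F A r * b := by
      change (a + algebraMap F A r * b) * S.coeff [] = _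
      rw [hS.2, mul_one]
    rw [h1, h2, ← hrel]
    ring
  have hx := DFunLike.congr_fun hg (some x)
  have hx' : algebraMap F C₀ (c x) * b' = 0 := by
    simpa [g, Finsupp.embDomain_apply_self Function.Embedding.some] using hx
  have hb' : b' ≠ 0 := fun h => hb0 (congrArg Subtype.val h)
  rcases mul_eq_zero.1 hx' with h0 | h0
  · exact (map_eq_zero_iff _ (FaithfulSMul.algebraMap_injective F C₀)).1 h0
  · exact absurd h0 hb'

/-- The case `f = 0` gives the independence of `u`. Conversely, a combination equal to a derivative
lies in the intersection, hence is zero, and independence kills its coefficients. -/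
theorem forall_eq_zero_iff_linearIndependent_and_inter_eq :
    (∀ f ∈ fracSubfield C₀, ∀ c : X →₀ F,
      (c.sum fun x r => r • φ (u x)) = fracDeriv D f → ∀ x, c x = 0) ↔
    LinearIndependent F u ∧
      (fracDeriv D '' (fracSubfield C₀ : Set (FractionRing A))) ∩
        (Submodule.span F (Set.range fun x => φ (u x)) : Set (FractionRing A)) = {0} := by
  have hcomb : ∀ c : X →₀ F, (c.sum fun x r => r • φ (u x)) =
      φ (Finsupp.linearCombination F u c) := by
    intro c
    rw [Finsupp.linearCombination_apply, Finsupp.sum, Finsupp.sum, map_sum]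
    exact Finset.sum_congr rfl fun x _ =>
      (map_smul (IsScalarTower.toAlgHom F A (FractionRing A)) _ _).symm
  constructor
  · intro h
    refine ⟨linearIndependent_iff.2 fun c hc => Finsupp.ext fun x =>
      h 0 (zero_mem _) c (by rw [hcomb, hc, map_zero, map_zero]) x, ?_⟩
    ext y
    simp only [Set.mem_inter_iff, Set.mem_image, SetLike.mem_coe, Set.mem_singleton_iff]
    constructor
    · rintro ⟨⟨f, hf, rfl⟩, hy⟩
      obtain ⟨c, hc⟩ := Finsupp.mem_span_range_iff_exists_finsupp.1 hy
      have hc0 : c = 0 := Finsupp.ext (h f hf c hc)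
      rw [← hc, hc0, Finsupp.sum_zero_index]
    · rintro rfl
      exact ⟨⟨0, zero_mem _, map_zero _⟩, zero_mem _⟩
  · rintro ⟨hlin, hint⟩ f hf c hc x
    have h0 : fracDeriv D f = 0 := by
      have : fracDeriv D f ∈ ({0} : Set (FractionRing A)) := by
        rw [← hint]
        exact ⟨⟨f, hf, rfl⟩, Finsupp.mem_span_range_iff_exists_finsupp.2 ⟨c, hc⟩⟩
      exact this
    rw [hcomb, h0, map_eq_zero_iff _ (IsFractionRing.injective A (FractionRing A))] at hc
    rw [linearIndependent_iff.1 hlin c hc, Finsupp.zero_apply]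

end Independence

end NCSeries

/-! ### The main theorem -/

theorem theorem3 {A X : Type*} [CommRing A] [IsDomain A] [Algebra ℂ A] [LinearOrder X]
    (D : Derivation ℂ A A)
    (hD : ∀ a : A, D a = 0 → ∃ c : ℂ, algebraMap ℂ A c = a)
    (C₀ : Subalgebra ℂ A) (hC₀ : ∀ a ∈ C₀, D a ∈ C₀)
    (u : X → A) (hu : ∀ x, u x ∈ C₀)
    (S : NCSeries A X) (hS : S.IsGroupLike) (hSol : S.IsSolution D u) :
    (∀ H : NCSeries A X, (H.IsGroupLike ∧ H.IsSolution D u) ↔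
      ∃ C : NCSeries ℂ X, C.IsLieSeries ∧ S = H * C.exp.map (algebraMap ℂ A)) ∧
    ((∀ a : A, ∀ b ∈ C₀, b ≠ 0 →
        fracDeriv D (algebraMap A (FractionRing A) a / algebraMap A (FractionRing A) b) = 0 →
        ∃ c : ℂ, algebraMap ℂ (FractionRing A) c =
          algebraMap A (FractionRing A) a / algebraMap A (FractionRing A) b) →
      List.TFAE [
        LinearIndependent C₀ (fun w : List X => S.coeff w),
        AlgebraicIndependent C₀ (fun l : {l : List X // IsLyndon l} => S.coeff l),
        AlgebraicIndependent C₀ (fun x : X => S.coeff [x]),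
        LinearIndependent C₀ (fun o : Option X => S.coeff (o.elim [] fun x => [x])),
        ∀ f ∈ fracSubfield C₀, ∀ c : X →₀ ℂ,
          (c.sum fun x r => r • algebraMap A (FractionRing A) (u x)) = fracDeriv D f →
          ∀ x, c x = 0,
        LinearIndependent ℂ u ∧
          (fracDeriv D '' (fracSubfield C₀ : Set (FractionRing A))) ∩
            (Submodule.span ℂ (Set.range fun x => algebraMap A (FractionRing A) (u x)) :
              Set (FractionRing A)) = {0}]) := by
  refine ⟨NCSeries.isGroupLike_and_isSolution_iff hD hS hSol, fun hconst => ?_⟩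
  -- For 5 → 1 only constants of `Frac C₀` occur. The full hypothesis serves 4 → 5, where the
  -- numerator involves coefficients of `S`.
  have hconst' : ∀ f ∈ fracSubfield C₀, fracDeriv D f = 0 →
      ∃ c : ℂ, algebraMap ℂ (FractionRing A) c = f := by
    intro f hf h
    obtain ⟨a, _, b, hb, hb0, rfl⟩ := mem_fracSubfield_iff.1 hf
    exact hconst a b hb hb0 h
  have : CharZero C₀ := charZero_of_injective_algebraMap (algebraMap ℂ C₀).injective
  tfae_have 1 → 2 := hS.algebraicIndependent_lyndon
  tfae_have 2 → 3 := fun h => h.comp (fun x : X => ⟨[x], isLyndon_singleton x⟩)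
    fun x y hxy => by simpa using hxy
  tfae_have 3 → 4 := fun h => by
    have h1 := NCSeries.linearIndependent_option_of_algebraicIndependent h
    have h2 : (fun o : Option X => S.coeff (o.elim [] fun x => [x])) =
        fun o => o.elim 1 fun x => S.coeff [x] := by
      funext o
      cases o with
      | none => exact hS.1
      | some x => rfl
    rw [h2]
    exact h1
  tfae_have 4 → 5 := fun h f hf c hc => hSol.eq_zero_of_sum_eq_fracDeriv hconst h hf c hc
  tfae_have 5 ↔ 6 := NCSeries.forall_eq_zero_iff_linearIndependent_and_inter_eq
  tfae_have 5 → 1 := hSol.linearIndependent hC₀ hu hconst'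
  tfae_finish
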